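/- **Setting.** Let $U\subset\mathbb R^n$ be a bounded open set, let $N\ge 1$ and let $0=\alpha_0<\alpha_1<\dots<\alpha_N$ be real numbers. Let $a_0,\dots,a_N\ge 0$ be measurable functions on $U$ with $a_0,a_N>0$, and let $\phi:U\to(0,1]$ be measurable. Put $$g(x,s)=\sum_{i=0}^N a_i(x)s^{\alpha_i},\qquad K(x,\xi)=\frac1{g(x,s(x,\xi))},\qquad H(x,\xi)=\int_0^{\xi^2}K(x,\sqrt s)\,ds\qquad(\xi\ge 0),$$ where $s=s(x,\xi)\ge 0$ is the unique non-negative solution of $s\,g(x,s)=\xi$, and $$a=\frac{\alpha_N}{\alpha_N+1}\in(0,1),\qquad W_1(x)=\frac{a_N(x)^a}{2N\max_{0\le j\le N}a_j(x)} .$$ Let $p$ solve $$\phi\,p_t=\nabla\cdot\big(K(x,|\nabla p|)\nabla p\big)\ \text{ in } U\times(0,\infty),\qquad p=\Psi\ \text{ on } \partial U\times(0,\infty),$$ with initial data $p(\cdot,0)$, where $\Psi(x,t)$ is a given function on $U\times[0,\infty)$ (an extension of the boundary data), and let $\bar p=p-\Psi$. The regularity of $p$ and $\Psi$ is as follows.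 For $u\in\{p,\Psi\}$: $u(t)\in W^{1,1}_{loc}(U)$ for $t\ge 0$; for $t>0$ the curves $t\mapsto u(t)$, $t\mapsto u_t(t)$ are differentiable in $L^2(U;\phi\,dx)$ (with derivatives $u_t$, $u_{tt}$) and $t\mapsto\nabla u(t)$ is differentiable in $L^2(U;a_0^{-1}dx)$, its derivative $\nabla u_t$ being the weak gradient of $u_t(t)\in W^{1,1}_{loc}(U)$; and $u(t)\to u(0)$ in $L^2(U;\phi\,dx)$ as $t\to0^+$. For each $t>0$, $K(x,|\nabla p|)\nabla p\in L^1_{loc}(U)$ and the equation holds when tested with $C^1$ functions compactly supported in $U$. The boundary condition means that, for each $t>0$, $\bar p(t)$ lies in the closure of these test functions in the norm $\big(\int_U|u|^2\phi\,dx+\int_U a_0^{-1}|\nabla u|^2dx\big)^{1/2}$. Moreover, for some constant $c_P>0$, $$\Big(\int_U|\bar p(x,t)|^2\phi\,dx\Big)^{1/2}\le c_P\Big(\int_U W_1|\nabla\bar p(x,t)|^{2-a}dx\Big)^{\frac1{2-a}}\qquad\text{for all } t>0 .$$ Let $B_*=\max\{\int_U a_N\,dx,1\}$ and $$G(t)=B_*+\int_U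 a_0^{-1}|\nabla\Psi(x,t)|^2dx+\int_U W_1|\nabla\Psi(x,t)|^{2-a}dx+\Big(\int_U|\Psi_t(x,t)|^2\phi\,dx\Big)^{\frac{2-a}{2(1-a)}},$$ $$G_1(t)=\int_U a_0^{-1}|\nabla\Psi_t(x,t)|^2dx,\qquad G_2(t)=\int_U|\Psi_{tt}(x,t)|^2\phi\,dx .$$ Assume that $G$, $G_1$, $G_2$ and $t\mapsto\int_U H(x,|\nabla p(x,t)|)dx$ are finite and continuous on $[0,\infty)$. Let $\mathcal A=\limsup_{t\to\infty}G(t)$, $\mathcal B=\limsup_{t\to\infty}[G'(t)]^-$ (the latter is considered when $G\in C^1((0,\infty))$), and let $\mathcal M$ denote any continuous increasing (non-decreasing) function on $[0,\infty)$ with $\mathcal M(t)\ge G(t)$ for all $t\ge0$. **Theorem.** There is a constant $C>0$, depending only on $n$, $U$, $N$, the exponents $\alpha_i$ and $c_P$ (not on the functions $a_i$, $\phi$, $p$, $\Psi$, $\mathcal M$, nor on $t_0$, $t$), such that the following hold. (i) For $t_0\in(0,1]$ and $t\ge t_0$, $$\int_U H(x,|\nabla p(x,t)|)dx+\int_U\bar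 p_t^2(x,t)\phi\,dx\le C\Big(t_0^{-1}\int_U\big[H(x,|\nabla p(x,0)|)+\bar p^2(x,0)\phi\big]dx+t_0^{-1}\int_0^{t_0}G_1(\tau)d\tau+\mathcal M(t)^{\frac2{2-a}}+\int_0^te^{-\frac14(t-\tau)}(G_1(\tau)+G_2(\tau))d\tau\Big).$$ (ii) For $t\ge1$, $$\int_U\bar p_t^2(x,t)\phi\,dx\le C\Big(\int_U\bar p^2(x,0)\phi\,dx+\mathcal M(t)^{\frac2{2-a}}+\int_{t-1}^t(G_1(\tau)+G_2(\tau))d\tau\Big).$$ (iii) If $\mathcal A<\infty$ then $$\limsup_{t\to\infty}\int_U\bar p_t^2(x,t)\phi\,dx\le C\Big(\mathcal A^{\frac2{2-a}}+\limsup_{t\to\infty}\int_{t-1}^t(G_1(\tau)+G_2(\tau))d\tau\Big),$$ and consequently $$\limsup_{t\to\infty}\int_U\bar p_t^2(x,t)\phi\,dx\le C\Big(\mathcal A^{\frac2{2-a}}+\limsup_{t\to\infty}(G_1(t)+G_2(t))\Big).$$ (iv) If $G\in C^1((0,\infty))$ and $\mathcal B<\infty$, then there is $T>0$ such that for all $t>T$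 $$\int_U\bar p_t^2(x,t)\phi\,dx\le C\Big(\mathcal B^{\frac1{1-a}}+G(t)^{\frac2{2-a}}+\int_{t-1}^t(G_1(\tau)+G_2(\tau))d\tau\Big).$$ -/

import Mathlib

open MeasureTheory Set Filter Topology
open scoped ENNReal NNReal

noncomputable section

namespace Forchheimer

/-- The Euclidean space `ℝⁿ`. -/
abbrev Space (n : ℕ) : Type := EuclideanSpace ℝ (Fin n)

/-! ### The generalized Forchheimer polynomial and the functions `K`, `H`, `W₁` -/

/-- The exponents `0 = α₀ < α₁ < ⋯ < α_N`, where `N ≥ 1`. -/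
structure IsExponents {N : ℕ} (α : Fin (N + 1) → ℝ) : Prop where
  one_le : 1 ≤ N
  zero : α 0 = 0
  strictMono : StrictMono α

/-- Admissible coefficient functions on `U`: measurable, with `a₀, a_N > 0` and the other
`aᵢ ≥ 0`. -/
structure IsCoefficients {n N : ℕ} (U : Set (Space n)) (a : Fin (N + 1) → Space n → ℝ) :
    Prop where
  aemeasurable : ∀ i, AEMeasurable (a i) (volume.restrict U)
  nonneg : ∀ i, ∀ x ∈ U, 0 ≤ a i x
  first_pos : ∀ x ∈ U, 0 < a 0 x
  last_pos : ∀ x ∈ U, 0 < a (Fin.last N) x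

/-- An admissible porosity on `U`: measurable with values in `(0, 1]`. -/
structure IsPorosity {n : ℕ} (U : Set (Space n)) (φ : Space n → ℝ) : Prop where
  aemeasurable : AEMeasurable φ (volume.restrict U)
  pos : ∀ x ∈ U, 0 < φ x
  le_one : ∀ x ∈ U, φ x ≤ 1

variable {n N : ℕ}

/-- `g(x, s) = a₀(x) s^{α₀} + ⋯ + a_N(x) s^{α_N}`. -/
def g (α : Fin (N + 1) → ℝ) (a : Fin (N + 1) → Space n → ℝ) (x : Space n) (s : ℝ) : ℝ :=
  ∑ i, a i x * s ^ α i

/-- `s(x, ξ)`: the non-negative solution `s` of `s g(x, s) = ξ`. -/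
def root (α : Fin (N + 1) → ℝ) (a : Fin (N + 1) → Space n → ℝ) (x : Space n) (ξ : ℝ) : ℝ :=
  Function.invFunOn (fun s => s * g α a x s) (Ici 0) ξ

/-- `K(x, ξ) = 1 / g(x, s(x, ξ))`. -/
def K (α : Fin (N + 1) → ℝ) (a : Fin (N + 1) → Space n → ℝ) (x : Space n) (ξ : ℝ) : ℝ :=
  1 / g α a x (root α a x ξ)

/-- `H(x, ξ) = ∫₀^{ξ²} K(x, √s) ds`. -/
def H (α : Fin (N + 1) → ℝ) (a : Fin (N + 1) → Space n → ℝ) (x : Space n) (ξ : ℝ) : ℝ :=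
  ∫ s in (0 : ℝ)..ξ ^ 2, K α a x (Real.sqrt s)

/-- The exponent `a = α_N / (α_N + 1) ∈ (0, 1)`. -/
def expo (α : Fin (N + 1) → ℝ) : ℝ := α (Fin.last N) / (α (Fin.last N) + 1)

/-- `M(x) = max {a_j(x) : j = 0, …, N}`. -/
def maxCoeff (a : Fin (N + 1) → Space n → ℝ) (x : Space n) : ℝ :=
  Finset.univ.sup' Finset.univ_nonempty (fun j => a j x)

/-- `W₁(x) = a_N(x)^a / (2 N M(x))`. -/
def W1 (α : Fin (N + 1) → ℝ) (a : Fin (N + 1) → Space n → ℝ) (x : Space n) : ℝ :=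
  a (Fin.last N) x ^ expo α / (2 * N * maxCoeff a x)

/-! ### Weighted `L²` spaces, weak gradients, time derivatives -/

/-- `∫_U f dx ∈ [0, ∞]` for a function `f ≥ 0`. -/
def posInt (U : Set (Space n)) (f : Space n → ℝ) : ℝ≥0∞ := ∫⁻ x in U, ENNReal.ofReal (f x)

/-- The measure `f(x) dx` on `U`. -/
def wMeasure (U : Set (Space n)) (f : Space n → ℝ) : Measure (Space n) :=
  (volume.restrict U).withDensity (fun x => ENNReal.ofReal (f x))

/-- Test functions: `C¹` functions with compact support in `U`. -/
structure IsTest (U : Set (Space n)) (w : Space n → ℝ) : Prop where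
  contDiff : ContDiff ℝ 1 w
  hasCompactSupport : HasCompactSupport w
  tsupport_subset : tsupport w ⊆ U

/-- `u ∈ W^{1,1}_loc(U)` and `v` is its weak gradient. -/
structure IsWeakGradient (U : Set (Space n)) (u : Space n → ℝ) (v : Space n → Space n) :
    Prop where
  locInt : LocallyIntegrableOn u U
  locIntGrad : LocallyIntegrableOn v U
  eq : ∀ w : Space n → ℝ, IsTest U w →
    ∫ x in U, u x • gradient w x = - ∫ x in U, w x • v x

/-- `f' ∈ L²(μ)` is the derivative at time `t` of the curve `f`: the difference quotients
converge to `f'` in `L²(μ)`. -/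
def HasL2DerivAt {F : Type*} [NormedAddCommGroup F] [NormedSpace ℝ F]
    (μ : Measure (Space n)) (f : ℝ → Space n → F) (f' : Space n → F) (t : ℝ) : Prop :=
  MemLp f' 2 μ ∧
    Tendsto (fun h : ℝ => eLpNorm (fun x => h⁻¹ • (f (t + h) x - f t x) - f' x) 2 μ)
      (𝓝[≠] 0) (𝓝 0)

/-- `u`, with weak gradient `v`, vanishes on `∂U`: it belongs to the closure of the test functions
for the norm `(∫_U |u|² φ + ∫_U b |∇u|²)^{1/2}`. -/
def VanishesOnBoundary (U : Set (Space n)) (φ b : Space n → ℝ)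
    (u : Space n → ℝ) (v : Space n → Space n) : Prop :=
  MemLp u 2 (wMeasure U φ) ∧ MemLp v 2 (wMeasure U b) ∧
    ∃ w : ℕ → Space n → ℝ, (∀ k, IsTest U (w k)) ∧
      Tendsto (fun k => eLpNorm (fun x => w k x - u x) 2 (wMeasure U φ)) atTop (𝓝 0) ∧
      Tendsto (fun k => eLpNorm (fun x => gradient (w k) x - v x) 2 (wMeasure U b)) atTop (𝓝 0)

/-- A function `u(x, t)` on `U × [0, ∞)` for which `∇u`, `u_t`, `∇u_t`, `u_tt` exist:
space derivatives are weak derivatives, time derivatives (for `t > 0`) are derivatives of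
`L²`-valued curves, with the weight `φ` for `u`, `u_t` and the weight `b` for `∇u`. At `t = 0`
the function is continuous with values in `L²_φ`. -/
structure RegularFun (U : Set (Space n)) (φ b : Space n → ℝ) where
  /-- `u(t)` -/
  val : ℝ → Space n → ℝ
  /-- `∇u(t)` -/
  grad : ℝ → Space n → Space n
  /-- `u_t(t)` -/
  dt : ℝ → Space n → ℝ
  /-- `∇u_t(t)` -/
  gradDt : ℝ → Space n → Space n
  /-- `u_tt(t)` -/
  dtt : ℝ → Space n → ℝ
  isWeakGradient : ∀ t, 0 ≤ t → IsWeakGradient U (val t) (grad t)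
  isWeakGradient_dt : ∀ t, 0 < t → IsWeakGradient U (dt t) (gradDt t)
  hasDeriv_val : ∀ t, 0 < t → HasL2DerivAt (wMeasure U φ) val (dt t) t
  hasDeriv_grad : ∀ t, 0 < t → HasL2DerivAt (wMeasure U b) grad (gradDt t) t
  hasDeriv_dt : ∀ t, 0 < t → HasL2DerivAt (wMeasure U φ) dt (dtt t) t
  continuous_zero :
    Tendsto (fun t => eLpNorm (fun x => val t x - val 0 x) 2 (wMeasure U φ)) (𝓝[>] 0) (𝓝 0)

/-- `p` solves `φ p_t = ∇·(K(x,|∇p|)∇p)` on `U × (0, ∞)` (tested, at each time, against test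
functions on `U`), and `p = Ψ` on `∂U × (0, ∞)`. The initial datum of `p` is `p.val 0`. -/
structure IsSolution (U : Set (Space n)) (α : Fin (N + 1) → ℝ) (a : Fin (N + 1) → Space n → ℝ)
    (φ : Space n → ℝ) (p Ψ : RegularFun U φ (fun x => (a 0 x)⁻¹)) : Prop where
  flux_locInt : ∀ t, 0 < t →
    LocallyIntegrableOn (fun x => K α a x ‖p.grad t x‖ • p.grad t x) U
  equation : ∀ t, 0 < t → ∀ w : Space n → ℝ, IsTest U w →
    ∫ x in U, φ x * p.dt t x * w x =
      - ∫ x in U, inner ℝ (K α a x ‖p.grad t x‖ • p.grad t x) (gradient w x)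
  boundary : ∀ t, 0 < t → VanishesOnBoundary U φ (fun x => (a 0 x)⁻¹)
    (fun x => p.val t x - Ψ.val t x) (fun x => p.grad t x - Ψ.grad t x)

/-! ### Time dependent quantities, all with values in `[0, ∞]` -/

/-- `f` is finite and continuous on `[0, ∞)`. -/
def FiniteContinuous (f : ℝ → ℝ≥0∞) : Prop :=
  (∀ t, 0 ≤ t → f t ≠ ⊤) ∧ ContinuousOn f (Ici 0)

section Quantities

variable {U : Set (Space n)} {φ b : Space n → ℝ}

/-- `∫_U p̄² φ dx` at time `t`, where `p̄ = p - Ψ`. -/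
def normSq (p Ψ : RegularFun U φ b) (t : ℝ) : ℝ≥0∞ :=
  posInt U (fun x => (p.val t x - Ψ.val t x) ^ 2 * φ x)

/-- `∫_U p̄_t² φ dx` at time `t`. -/
def normSqDt (p Ψ : RegularFun U φ b) (t : ℝ) : ℝ≥0∞ :=
  posInt U (fun x => (p.dt t x - Ψ.dt t x) ^ 2 * φ x)

/-- `∫_U H(x, |∇p|) dx` at time `t`. -/
def intH (α : Fin (N + 1) → ℝ) (a : Fin (N + 1) → Space n → ℝ) (p : RegularFun U φ b)
    (t : ℝ) : ℝ≥0∞ :=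
  posInt U (fun x => H α a x ‖p.grad t x‖)

/-- `B_* = max {∫_U a_N dx, 1}`. -/
def Bstar (U : Set (Space n)) (a : Fin (N + 1) → Space n → ℝ) : ℝ≥0∞ :=
  max (posInt U (a (Fin.last N))) 1

/-- `G(t)`. -/
def G (α : Fin (N + 1) → ℝ) (a : Fin (N + 1) → Space n → ℝ) (Ψ : RegularFun U φ b)
    (t : ℝ) : ℝ≥0∞ :=
  Bstar U a + posInt U (fun x => (a 0 x)⁻¹ * ‖Ψ.grad t x‖ ^ 2)
    + posInt U (fun x => W1 α a x * ‖Ψ.grad t x‖ ^ (2 - expo α))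
    + posInt U (fun x => Ψ.dt t x ^ 2 * φ x) ^ ((2 - expo α) / (2 * (1 - expo α)))

/-- `G₁(t) = ∫_U a₀⁻¹ |∇Ψ_t|² dx`. -/
def G1 (a : Fin (N + 1) → Space n → ℝ) (Ψ : RegularFun U φ b) (t : ℝ) : ℝ≥0∞ :=
  posInt U (fun x => (a 0 x)⁻¹ * ‖Ψ.gradDt t x‖ ^ 2)

/-- `G₂(t) = ∫_U |Ψ_tt|² φ dx`. -/
def G2 (Ψ : RegularFun U φ b) (t : ℝ) : ℝ≥0∞ :=
  posInt U (fun x => Ψ.dtt t x ^ 2 * φ x)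

/-- `𝓐 = limsup_{t → ∞} G(t)`. -/
def limA (α : Fin (N + 1) → ℝ) (a : Fin (N + 1) → Space n → ℝ) (Ψ : RegularFun U φ b) : ℝ≥0∞ :=
  limsup (G α a Ψ) atTop

/-- `𝓑 = limsup_{t → ∞} [G'(t)]⁻`. -/
def limB (α : Fin (N + 1) → ℝ) (a : Fin (N + 1) → Space n → ℝ) (Ψ : RegularFun U φ b) : ℝ≥0∞ :=
  limsup (fun t => ENNReal.ofReal (- deriv (fun s => (G α a Ψ s).toReal) t)) atTop

/-- The two-weight Poincaré–Sobolev inequality for `u = p̄(t)`, `t > 0`, with constant `c_P`. -/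
def PoincareSobolev (α : Fin (N + 1) → ℝ) (a : Fin (N + 1) → Space n → ℝ) (cP : ℝ)
    (p Ψ : RegularFun U φ b) : Prop :=
  ∀ t, 0 < t → normSq p Ψ t ^ (1 / 2 : ℝ) ≤ ENNReal.ofReal cP *
    posInt U (fun x => W1 α a x * ‖p.grad t x - Ψ.grad t x‖ ^ (2 - expo α)) ^ (1 / (2 - expo α))

end Quantities

/-- `𝓜` is a continuous increasing function on `[0, ∞)` with `𝓜 ≥ G`. -/
structure IsMajorant (G : ℝ → ℝ≥0∞) (M : ℝ → ℝ) : Prop where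
  continuousOn : ContinuousOn M (Ici 0)
  monotoneOn : MonotoneOn M (Ici 0)
  le : ∀ t, 0 ≤ t → G t ≤ ENNReal.ofReal (M t)

end Forchheimer

end

/-!
Energy estimates for `p̄ = p - Ψ`. Write `r = 2 - a ∈ (1, 2)`, `F(x, v) = K(x, |v|) v`,
`y = ∫ p̄² φ`, `z = ∫ p̄_t² φ`, `I = ∫ H(x, |∇p|)`. Testing the equation with `p̄`, testing it with
`p̄_t`, and testing its time derivative with `p̄_t` give, for a constant `c` depending only on `r`
and `c_P`,

* `y' ≤ -I / 4 + c G`, where `y' = 2 ∫ p̄ p̄_t φ` and `y^{r/2} ≤ c (I + G)`;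
* `I' ≤ -z + I + G + G₁`;
* `z' ≤ z / 2 + G₁ / 2 + 2 G₂`.

These are collected in `EnergyInequalities`, and the rest is a study of this system of scalar
inequalities. Eliminating `I` from the first line, `y' ≤ -y^{r/2} / (4c) + 2 c G`, so `y` lies
(eventually) below any supersolution: a constant multiple of `m^{2/r}` if `G ≤ m`, and
`(16 c² (G + β))^{2/r}` with `β` a multiple of `b^{r / (2 (r - 1))}` if `G' ≥ -b`. The functional
`(τ - s)² z + (5/2)(τ - s) I + 20 y` then bounds `z(t)` by `y(t - 1/2)` and the data on `[t - 1, t]`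
(`EnergyInequalities.z_le`), which gives the three estimates of `z` alone. For the estimate of
`I + z` the functional `τ z + (3/2) I + 6 y` on `[0, t₀]` is combined with Grönwall's inequality on
`[t₀, t]`.

The three energy inequalities are proved for curves in the Hilbert spaces `L²(φ dx)` and
`L²(a₀⁻¹ dx)` (`EvolutionCurves`). Three facts keep the regularity assumptions sufficient. The map
`v ↦ H(x, |v|)` is convex with gradient `2 F(x, v)`, and convexity inequalities alone determine the
derivative of `I`. The flux `F` inverts the monotone map `u ↦ g(x, |u|) u`, whence
`a₀ |F(v) - F(w)|² ≤ (F(v) - F(w)) · (v - w)`; applied to difference quotients in time, this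
replaces a differentiation of the flux. Finally the weak formulation at time `t` may be tested with
`p̄(s)` for every `s > 0`; differentiating in `s` shows that it may be tested with `p̄_t`.
-/

noncomputable section

namespace Forchheimer

/-! ### The constitutive functions at a fixed point -/

section Pointwise

variable {n N : ℕ} {α : Fin (N + 1) → ℝ} {a : Fin (N + 1) → Space n → ℝ} {x : Space n}

theorem IsExponents.nonneg (hα : IsExponents α) (i : Fin (N + 1)) : 0 ≤ α i := by
  rw [← hα.zero]; exact hα.strictMono.monotone (Fin.zero_le i)

theorem IsExponents.last_pos (hα : IsExponents α) : 0 < α (Fin.last N) := by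
  rw [← hα.zero]
  apply hα.strictMono
  have := hα.one_le
  rw [Fin.lt_def]
  simp only [Fin.val_zero, Fin.val_last]
  omega

theorem expo_pos (hα : IsExponents α) : 0 < expo α := by
  have := hα.last_pos
  unfold expo; positivity

theorem expo_lt_one (hα : IsExponents α) : expo α < 1 := by
  have := hα.last_pos
  unfold expo
  rw [div_lt_one (by linarith)]
  linarith

/-- Positivity of the coefficients at the point `x`: all `aᵢ(x) ≥ 0` and `a₀(x) > 0`. -/
structure CoeffAt (a : Fin (N + 1) → Space n → ℝ) (x : Space n) : Prop where
  nonneg : ∀ i, 0 ≤ a i x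
  pos : 0 < a 0 x

theorem IsCoefficients.coeffAt {U : Set (Space n)} (ha : IsCoefficients U a) (hx : x ∈ U) :
    CoeffAt a x := ⟨fun i => ha.nonneg i x hx, ha.first_pos x hx⟩

theorem continuous_g (hα : IsExponents α) : Continuous (g α a x) := by
  unfold g
  exact continuous_finsetSum _ fun i _ =>
    continuous_const.mul (Real.continuous_rpow_const (hα.nonneg i))

theorem g_mono (hα : IsExponents α) (ha : CoeffAt a x) {s t : ℝ} (hs : 0 ≤ s) (hst : s ≤ t) :
    g α a x s ≤ g α a x t :=
  Finset.sum_le_sum fun i _ => mul_le_mul_of_nonneg_left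
    (Real.rpow_le_rpow hs hst (hα.nonneg i)) (ha.nonneg i)

theorem first_le_g (hα : IsExponents α) (ha : CoeffAt a x) {s : ℝ} (hs : 0 ≤ s) :
    a 0 x ≤ g α a x s := by
  have h := Finset.single_le_sum (f := fun i => a i x * s ^ α i)
    (fun i _ => mul_nonneg (ha.nonneg i) (Real.rpow_nonneg hs _)) (Finset.mem_univ 0)
  simpa [hα.zero, g] using h

theorem g_pos (hα : IsExponents α) (ha : CoeffAt a x) {s : ℝ} (hs : 0 ≤ s) : 0 < g α a x s :=
  ha.pos.trans_le (first_le_g hα ha hs)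

theorem exists_root (hα : IsExponents α) (ha : CoeffAt a x) {ξ : ℝ} (hξ : 0 ≤ ξ) :
    ∃ s ∈ Ici (0 : ℝ), s * g α a x s = ξ := by
  have h0 := ha.pos
  have hnn : 0 ≤ ξ / a 0 x := by positivity
  have hc : ContinuousOn (fun s => s * g α a x s) (Icc 0 (ξ / a 0 x)) :=
    (continuous_id.mul (continuous_g hα)).continuousOn
  have hup : ξ ≤ ξ / a 0 x * g α a x (ξ / a 0 x) := by
    calc ξ = ξ / a 0 x * a 0 x := by field_simp
      _ ≤ _ := mul_le_mul_of_nonneg_left (first_le_g hα ha hnn) hnn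
  obtain ⟨s, hs, hsξ⟩ := intermediate_value_Icc hnn hc
    (show ξ ∈ Icc _ _ from ⟨by simpa using hξ, hup⟩)
  exact ⟨s, hs.1, hsξ⟩

theorem root_nonneg (hα : IsExponents α) (ha : CoeffAt a x) {ξ : ℝ} (hξ : 0 ≤ ξ) :
    0 ≤ root α a x ξ :=
  Function.invFunOn_mem (exists_root hα ha hξ)

theorem root_mul_g (hα : IsExponents α) (ha : CoeffAt a x) {ξ : ℝ} (hξ : 0 ≤ ξ) :
    root α a x ξ * g α a x (root α a x ξ) = ξ :=
  Function.invFunOn_eq (exists_root hα ha hξ)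

theorem mul_g_strong_mono (hα : IsExponents α) (ha : CoeffAt a x) {s t : ℝ} (hs : 0 ≤ s)
    (hst : s ≤ t) : a 0 x * (t - s) ≤ t * g α a x t - s * g α a x s := by
  have h1 := g_mono hα ha hs hst
  have h2 := first_le_g hα ha (hs.trans hst)
  nlinarith [mul_le_mul_of_nonneg_left h1 hs,
    mul_le_mul_of_nonneg_right h2 (sub_nonneg.2 hst)]

theorem root_mono (hα : IsExponents α) (ha : CoeffAt a x) {ξ η : ℝ} (hξ : 0 ≤ ξ) (h : ξ ≤ η) :
    root α a x ξ ≤ root α a x η := by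
  by_contra! hc
  have h1 := mul_g_strong_mono hα ha (root_nonneg hα ha (hξ.trans h)) hc.le
  rw [root_mul_g hα ha hξ, root_mul_g hα ha (hξ.trans h)] at h1
  have := mul_pos ha.pos (sub_pos.2 hc)
  linarith

theorem root_sub_le (hα : IsExponents α) (ha : CoeffAt a x) {ξ η : ℝ} (hξ : 0 ≤ ξ) (h : ξ ≤ η) :
    a 0 x * (root α a x η - root α a x ξ) ≤ η - ξ := by
  have h1 := mul_g_strong_mono hα ha (root_nonneg hα ha hξ) (root_mono hα ha hξ h)
  rwa [root_mul_g hα ha hξ, root_mul_g hα ha (hξ.trans h)] at h1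

theorem continuousOn_root (hα : IsExponents α) (ha : CoeffAt a x) :
    ContinuousOn (root α a x) (Ici 0) := by
  have h0 := ha.pos
  have key : ∀ ξ ∈ Ici (0 : ℝ), ∀ η ∈ Ici (0 : ℝ), ξ ≤ η →
      |root α a x η - root α a x ξ| ≤ (a 0 x)⁻¹ * |η - ξ| := by
    intro ξ hξ η _ h
    rw [abs_of_nonneg (sub_nonneg.2 (root_mono hα ha hξ h)), abs_of_nonneg (sub_nonneg.2 h),
      ← div_eq_inv_mul, le_div_iff₀ h0, mul_comm]
    exact root_sub_le hα ha hξ h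
  have hL : LipschitzOnWith ⟨(a 0 x)⁻¹, by positivity⟩ (root α a x) (Ici 0) := by
    refine LipschitzOnWith.of_dist_le_mul fun ξ hξ η hη => ?_
    rw [Real.dist_eq, Real.dist_eq]
    rcases le_total ξ η with h | h
    · rw [abs_sub_comm, abs_sub_comm ξ]; exact key ξ hξ η hη h
    · exact key η hη ξ hξ h
  exact hL.continuousOn

theorem K_pos (hα : IsExponents α) (ha : CoeffAt a x) {ξ : ℝ} (hξ : 0 ≤ ξ) : 0 < K α a x ξ :=
  one_div_pos.2 (g_pos hα ha (root_nonneg hα ha hξ))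

theorem K_mul_self (hα : IsExponents α) (ha : CoeffAt a x) {ξ : ℝ} (hξ : 0 ≤ ξ) :
    K α a x ξ * ξ = root α a x ξ := by
  have h := g_pos hα ha (root_nonneg hα ha hξ)
  have h2 := root_mul_g hα ha hξ
  unfold K
  rw [one_div, inv_mul_eq_iff_eq_mul₀ h.ne']
  linarith

theorem K_antitone (hα : IsExponents α) (ha : CoeffAt a x) {ξ η : ℝ} (hξ : 0 ≤ ξ) (h : ξ ≤ η) :
    K α a x η ≤ K α a x ξ :=
  one_div_le_one_div_of_le (g_pos hα ha (root_nonneg hα ha hξ))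
    (g_mono hα ha (root_nonneg hα ha hξ) (root_mono hα ha hξ h))

theorem continuous_K_sqrt (hα : IsExponents α) (ha : CoeffAt a x) :
    Continuous fun s => K α a x (Real.sqrt s) := by
  have h1 : Continuous fun s => root α a x (Real.sqrt s) :=
    (continuousOn_root hα ha).comp_continuous Real.continuous_sqrt fun s => Real.sqrt_nonneg s
  unfold K
  exact continuous_const.div ((continuous_g hα).comp h1)
    fun s => (g_pos hα ha (root_nonneg hα ha (Real.sqrt_nonneg s))).ne'

/-- `∂H/∂ξ = 2 ξ K(x, ξ) = 2 s(x, ξ)`. -/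
theorem hasDerivAt_H (hα : IsExponents α) (ha : CoeffAt a x) {ξ : ℝ} (hξ : 0 ≤ ξ) :
    HasDerivAt (H α a x) (2 * root α a x ξ) ξ := by
  have hc := continuous_K_sqrt hα ha
  have h1 : HasDerivAt (fun r : ℝ => ∫ s in (0 : ℝ)..r, K α a x (Real.sqrt s))
      (K α a x (Real.sqrt (ξ ^ 2))) (ξ ^ 2) :=
    intervalIntegral.integral_hasDerivAt_right (hc.intervalIntegrable _ _)
      (hc.stronglyMeasurableAtFilter _ _) hc.continuousAt
  have h2 := HasDerivAt.comp (h := fun r : ℝ => r ^ 2) ξ h1 (hasDerivAt_pow 2 ξ)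
  have e : K α a x (Real.sqrt (ξ ^ 2)) * ((2 : ℕ) * ξ ^ (2 - 1)) = 2 * root α a x ξ := by
    rw [Real.sqrt_sq hξ, ← K_mul_self hα ha hξ]
    push_cast
    ring
  rw [e] at h2
  exact h2

/-- Convexity of `H(x, ·)`, from the monotonicity of `∂H/∂ξ` and the mean value theorem. -/
theorem H_convex (hα : IsExponents α) (ha : CoeffAt a x) {ξ η : ℝ} (hξ : 0 ≤ ξ) (hη : 0 ≤ η) :
    2 * root α a x ξ * (η - ξ) ≤ H α a x η - H α a x ξ := by
  have hcont : ∀ {u v : ℝ}, 0 ≤ u → ContinuousOn (H α a x) (Icc u v) := fun hu w hw =>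
    (hasDerivAt_H hα ha (hu.trans hw.1)).continuousAt.continuousWithinAt
  rcases lt_trichotomy ξ η with h | h | h
  · obtain ⟨c, hc, hce⟩ := exists_hasDerivAt_eq_slope (H α a x) (fun w => 2 * root α a x w) h
      (hcont hξ) fun w hw => hasDerivAt_H hα ha (hξ.trans hw.1.le)
    rw [eq_div_iff (sub_pos.2 h).ne'] at hce
    rw [← hce]
    have := root_mono hα ha hξ hc.1.le
    exact mul_le_mul_of_nonneg_right (by linarith) (sub_nonneg.2 h.le)
  · simp [h]
  · obtain ⟨c, hc, hce⟩ := exists_hasDerivAt_eq_slope (H α a x) (fun w => 2 * root α a x w) h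
      (hcont hη) fun w hw => hasDerivAt_H hα ha (hη.trans hw.1.le)
    rw [eq_div_iff (sub_pos.2 h).ne'] at hce
    have := root_mono hα ha (hη.trans hc.1.le) hc.2.le
    have := mul_le_mul_of_nonneg_right this (sub_nonneg.2 h.le)
    nlinarith

theorem H_zero : H α a x 0 = 0 := by simp [H]

theorem root_mul_le_H (hα : IsExponents α) (ha : CoeffAt a x) {ξ : ℝ} (hξ : 0 ≤ ξ) :
    root α a x ξ * ξ ≤ H α a x ξ := by
  have hc := continuous_K_sqrt hα ha
  have h := intervalIntegral.integral_mono_on (sq_nonneg ξ)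
    (intervalIntegrable_const (c := K α a x ξ) (μ := volume)) (hc.intervalIntegrable _ _)
    fun s hs => K_antitone hα ha (Real.sqrt_nonneg s) 
      ((Real.sqrt_le_sqrt hs.2).trans (Real.sqrt_sq hξ).le)
  rw [intervalIntegral.integral_const] at h
  rw [← K_mul_self hα ha hξ]
  calc _ = (ξ ^ 2 - 0) • K α a x ξ := by rw [smul_eq_mul]; ring
    _ ≤ _ := h

theorem H_nonneg (hα : IsExponents α) (ha : CoeffAt a x) {ξ : ℝ} (hξ : 0 ≤ ξ) :
    0 ≤ H α a x ξ :=
  (mul_nonneg (root_nonneg hα ha hξ) hξ).trans (root_mul_le_H hα ha hξ)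

theorem H_le_root_mul (hα : IsExponents α) (ha : CoeffAt a x) {ξ : ℝ} (hξ : 0 ≤ ξ) :
    H α a x ξ ≤ 2 * (root α a x ξ * ξ) := by
  have h := H_convex hα ha hξ le_rfl
  rw [H_zero] at h
  linarith

theorem le_maxCoeff (i : Fin (N + 1)) : a i x ≤ maxCoeff a x :=
  Finset.le_sup' (fun j => a j x) (Finset.mem_univ i)

theorem g_le (ha : CoeffAt a x) {s m : ℝ} (hs : 0 ≤ s)
    (hm : ∀ i, s ^ α i ≤ m) : g α a x s ≤ (N + 1) * (maxCoeff a x * m) := by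
  have h : g α a x s ≤ ∑ _i : Fin (N + 1), maxCoeff a x * m :=
    Finset.sum_le_sum fun i _ => mul_le_mul (le_maxCoeff i) (hm i) (Real.rpow_nonneg hs _)
      ((ha.nonneg 0).trans (le_maxCoeff 0))
  simpa using h

theorem last_mul_le_g (ha : CoeffAt a x) {s : ℝ} (hs : 0 ≤ s) :
    a (Fin.last N) x * s ^ α (Fin.last N) ≤ g α a x s :=
  Finset.single_le_sum (f := fun i => a i x * s ^ α i)
    (fun i _ => mul_nonneg (ha.nonneg i) (Real.rpow_nonneg hs _)) (Finset.mem_univ _)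

theorem W1_nonneg (ha : CoeffAt a x) : 0 ≤ W1 α a x := by
  have h1 := ha.nonneg (Fin.last N)
  have h2 := (ha.nonneg 0).trans (le_maxCoeff 0)
  unfold W1; positivity

/-- Coercivity. For `s ≥ 1` the term `a_N s^{α_N}` dominates `g`; for `s < 1` one has
`g ≤ (N + 1) max a_j`, and Young's inequality produces the additive term `a_N`. -/
theorem W1_mul_rpow_le (hα : IsExponents α) (ha : CoeffAt a x) (hN : 0 < a (Fin.last N) x) {ξ : ℝ}
    (hξ : 0 ≤ ξ) :
    W1 α a x * ξ ^ (2 - expo α) ≤ root α a x ξ * ξ + a (Fin.last N) x := by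
  set s := root α a x ξ with hs_def
  have hs : 0 ≤ s := root_nonneg hα ha hξ
  have hξs : s * g α a x s = ξ := root_mul_g hα ha hξ
  have hg := g_pos hα ha hs
  set γ := g α a x s
  set A := a (Fin.last N) x
  set M := maxCoeff a x
  have hM : 0 < M := ha.pos.trans_le (le_maxCoeff 0)
  have hN1 : (1 : ℝ) ≤ N := by exact_mod_cast hα.one_le
  have he0 := expo_pos hα
  have he1 := expo_lt_one hα
  have hαN := hα.last_pos
  have hee : expo α * (α (Fin.last N) + 1) = α (Fin.last N) := by
    unfold expo; field_simp
  set e := expo α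
  have hW : W1 α a x = A ^ e / (2 * N * M) := rfl
  rcases hs.eq_or_lt with h0 | hspos
  · have : ξ = 0 := by rw [← hξs, ← h0, zero_mul]
    rw [this, Real.zero_rpow (by linarith)]
    simp [hN.le]
  have hAe : 0 < A ^ e := Real.rpow_pos_of_pos hN e
  -- `A^e γ^{1-e} s^{2-e} ≤ γ s² + A` suffices since `γ ≤ (N + 1) M max(1, s)^{α_N}`
  have hpow : ξ ^ (2 - e) = (γ * s ^ 2) * (γ ^ (1 - e) * s ^ (-e)) := by
    rw [← hξs, Real.mul_rpow hs hg.le]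
    have h1 : s ^ (2 - e) = s ^ 2 * s ^ (-e) := by
      rw [← Real.rpow_two, ← Real.rpow_add hspos]; ring_nf
    have h2 : γ ^ (2 - e) = γ * γ ^ (1 - e) := by
      nth_rewrite 2 [← Real.rpow_one γ]
      rw [← Real.rpow_add hg]; ring_nf
    rw [h1, h2]; ring
  have hrξ : s * ξ = γ * s ^ 2 := by rw [← hξs]; ring
  rw [hW, hrξ, div_mul_eq_mul_div, div_le_iff₀ (by positivity)]
  have hNN : (N + 1 : ℝ) ≤ 2 * N := by linarith
  rcases le_or_gt 1 s with h1 | h1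
  · have hgle : γ ≤ (N + 1) * (M * s ^ α (Fin.last N)) := g_le ha hs fun i =>
      Real.rpow_le_rpow_of_exponent_le h1 (hα.strictMono.monotone (Fin.le_last i))
    have hgge : A * s ^ α (Fin.last N) ≤ γ := last_mul_le_g ha hs
    have hsα : 0 < s ^ α (Fin.last N) := Real.rpow_pos_of_pos hspos _
    have h2 : γ ^ (1 - e) = γ * γ ^ (-e) := by
      nth_rewrite 2 [← Real.rpow_one γ]
      rw [← Real.rpow_add hg]; ring_nf
    have h3 : γ ^ (-e) ≤ (A * s ^ α (Fin.last N)) ^ (-e) :=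
      Real.rpow_le_rpow_of_nonpos (by positivity) hgge (by linarith)
    have h4 : (A * s ^ α (Fin.last N)) ^ (-e) = (A ^ e)⁻¹ * s ^ (-(α (Fin.last N)) * e) := by
      rw [Real.mul_rpow hN.le hsα.le, Real.rpow_neg hN.le, ← Real.rpow_mul hs]; ring_nf
    have h5 : s ^ α (Fin.last N) * s ^ (-(α (Fin.last N)) * e) * s ^ (-e) = 1 := by
      rw [← Real.rpow_add hspos, ← Real.rpow_add hspos]
      convert Real.rpow_zero s using 2
      linarith
    have h6 : A ^ e * (γ ^ (1 - e) * s ^ (-e)) ≤ (N + 1) * M := by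
      rw [h2]
      calc A ^ e * (γ * γ ^ (-e) * s ^ (-e))
          ≤ A ^ e * ((N + 1) * (M * s ^ α (Fin.last N)) *
              ((A ^ e)⁻¹ * s ^ (-(α (Fin.last N)) * e)) * s ^ (-e)) := by
            rw [← h4]; gcongr
        _ = (A ^ e * (A ^ e)⁻¹) * ((N + 1) * M) *
              (s ^ α (Fin.last N) * s ^ (-(α (Fin.last N)) * e) * s ^ (-e)) := by ring
        _ = (N + 1) * M := by rw [h5, mul_inv_cancel₀ hAe.ne']; ring
    rw [hpow]
    calc A ^ e * (γ * s ^ 2 * (γ ^ (1 - e) * s ^ (-e)))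
        = γ * s ^ 2 * (A ^ e * (γ ^ (1 - e) * s ^ (-e))) := by ring
      _ ≤ γ * s ^ 2 * ((N + 1) * M) := by gcongr
      _ ≤ (γ * s ^ 2 + A) * (2 * N * M) := by gcongr; linarith
  · have hgle : γ ≤ (N + 1) * (M * 1) := g_le ha hs fun i =>
      Real.rpow_le_one hs h1.le (hα.nonneg i)
    have hy := Real.geom_mean_le_arith_mean2_weighted (sub_nonneg.2 he1.le) he0.le
      (by positivity : 0 ≤ γ * s ^ 2) hN.le (by ring)
    have h7 : (γ * s ^ 2) ^ (1 - e) * A ^ e ≤ γ * s ^ 2 + A := by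
      have : 0 ≤ γ * s ^ 2 := by positivity
      nlinarith
    have h8 : (γ * s ^ 2) ^ (1 - e) = γ ^ (1 - e) * s ^ (-e) * s ^ (2 - e) := by
      rw [Real.mul_rpow hg.le (by positivity), ← Real.rpow_two, ← Real.rpow_mul hs, mul_assoc,
        ← Real.rpow_add hspos]; ring_nf
    have h9 : s ^ 2 * s ^ (-e) ≤ s ^ (-e) * s ^ (2 - e) := by
      rw [mul_comm]
      refine mul_le_mul_of_nonneg_left ?_ (Real.rpow_nonneg hs _)
      rw [← Real.rpow_two]
      exact Real.rpow_le_rpow_of_exponent_ge hspos h1.le (by linarith)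
    rw [hpow]
    calc A ^ e * (γ * s ^ 2 * (γ ^ (1 - e) * s ^ (-e)))
        = γ * (A ^ e * γ ^ (1 - e) * (s ^ 2 * s ^ (-e))) := by ring
      _ ≤ (N + 1) * (M * 1) * (A ^ e * γ ^ (1 - e) * (s ^ (-e) * s ^ (2 - e))) := by
          gcongr
      _ = (N + 1) * M * ((γ * s ^ 2) ^ (1 - e) * A ^ e) := by rw [h8]; ring
      _ ≤ (N + 1) * M * (γ * s ^ 2 + A) := by gcongr
      _ ≤ (γ * s ^ 2 + A) * (2 * N * M) := by
          rw [mul_comm]; gcongr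

/-- The flux `F(x, v) = K(x, |v|) v`. -/
def flux (α : Fin (N + 1) → ℝ) (a : Fin (N + 1) → Space n → ℝ) (x v : Space n) : Space n :=
  K α a x ‖v‖ • v

theorem norm_flux (hα : IsExponents α) (ha : CoeffAt a x) (v : Space n) :
    ‖flux α a x v‖ = root α a x ‖v‖ := by
  rw [flux, norm_smul, Real.norm_of_nonneg (K_pos hα ha (norm_nonneg v)).le,
    K_mul_self hα ha (norm_nonneg v)]

theorem first_mul_norm_flux_le (hα : IsExponents α) (ha : CoeffAt a x) (v : Space n) :
    a 0 x * ‖flux α a x v‖ ≤ ‖v‖ := by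
  have h := root_sub_le hα ha le_rfl (norm_nonneg v)
  have h0 : root α a x 0 = 0 := by
    rw [← K_mul_self hα ha le_rfl, mul_zero]
  rw [norm_flux hα ha]
  simpa [h0] using h

theorem inner_flux_self (hα : IsExponents α) (ha : CoeffAt a x) (v : Space n) :
    inner ℝ (flux α a x v) v = root α a x ‖v‖ * ‖v‖ := by
  rw [flux, real_inner_smul_left, real_inner_self_eq_norm_sq, ← K_mul_self hα ha (norm_nonneg v)]
  ring

/-- `F` is inverted by `u ↦ g(x, |u|) u`. -/
theorem g_norm_flux_smul (hα : IsExponents α) (ha : CoeffAt a x) (v : Space n) :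
    g α a x ‖flux α a x v‖ • flux α a x v = v := by
  rw [norm_flux hα ha, flux, smul_smul]
  have := g_pos hα ha (root_nonneg hα ha (norm_nonneg v))
  rw [K, mul_one_div, div_self this.ne', one_smul]

/-- Co-coercivity of the flux, i.e. strong monotonicity, with constant `a₀`, of its inverse
`u ↦ g(x, |u|) u`. -/
theorem flux_cocoercive (hα : IsExponents α) (ha : CoeffAt a x) (v w : Space n) :
    a 0 x * ‖flux α a x v - flux α a x w‖ ^ 2 ≤
      inner ℝ (flux α a x v - flux α a x w) (v - w) := by
  have hv := g_norm_flux_smul hα ha v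
  have hw := g_norm_flux_smul hα ha w
  set p := flux α a x v
  set q := flux α a x w
  have e1 : inner ℝ (p - q) (v - w) = g α a x ‖p‖ * ‖p‖ ^ 2 + g α a x ‖q‖ * ‖q‖ ^ 2
      - (g α a x ‖p‖ + g α a x ‖q‖) * inner ℝ p q := by
    rw [← hv, ← hw]
    simp only [inner_sub_left, inner_sub_right, real_inner_smul_right, real_inner_self_eq_norm_sq,
      real_inner_comm p q]
    ring
  rw [e1, norm_sub_sq_real]
  have hcs := real_inner_le_norm p q
  have hp := first_le_g hα ha (norm_nonneg p)
  have hq := first_le_g hα ha (norm_nonneg q)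
  have hmono : 0 ≤ ((g α a x ‖p‖ - a 0 x) * ‖p‖ - (g α a x ‖q‖ - a 0 x) * ‖q‖) *
      (‖p‖ - ‖q‖) := by
    rcases le_total ‖p‖ ‖q‖ with h | h
    · have := g_mono hα ha (norm_nonneg p) h
      refine mul_nonneg_of_nonpos_of_nonpos (sub_nonpos.2 ?_) (sub_nonpos.2 h)
      exact mul_le_mul (by linarith) h (norm_nonneg _) (by linarith)
    · have := g_mono hα ha (norm_nonneg q) h
      refine mul_nonneg (sub_nonneg.2 ?_) (sub_nonneg.2 h)
      exact mul_le_mul (by linarith) h (norm_nonneg _) (by linarith)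
  nlinarith [mul_le_mul_of_nonneg_left hcs
    (by linarith : 0 ≤ (g α a x ‖p‖ - a 0 x) + (g α a x ‖q‖ - a 0 x))]

/-- `v ↦ H(x, |v|)` is convex with gradient `2 F(x, v)`. -/
theorem inner_flux_le_H_sub (hα : IsExponents α) (ha : CoeffAt a x) (v w : Space n) :
    2 * inner ℝ (flux α a x v) (w - v) ≤ H α a x ‖w‖ - H α a x ‖v‖ := by
  refine le_trans ?_ (H_convex hα ha (norm_nonneg v) (norm_nonneg w))
  have h1 := real_inner_le_norm (flux α a x v) w
  rw [norm_flux hα ha] at h1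
  rw [inner_sub_right, inner_flux_self hα ha]
  linarith

end Pointwise

/-! ### Energy identities in Hilbert spaces -/

section Hilbert

variable {X V : Type*} [NormedAddCommGroup X] [InnerProductSpace ℝ X]
  [NormedAddCommGroup V] [InnerProductSpace ℝ V]

/-- The evolution problem written with curves in two Hilbert spaces, for times `t > 0`: `u = p̄` and
`ψ = Ψ_t` with values in `X = L²(φ dx)`, `v = ∇p`, `q = ∇Ψ` and the rescaled flux
`R = a₀ K(x, |∇p|) ∇p` with values in `V = L²(a₀⁻¹ dx)`, and the energy `I = ∫ H(x, |∇p|) dx`.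
Derivatives in time carry a prime. The weak formulation at time `t` is tested with `p̄(s)` for
*all* times `s`, so that it may be differentiated in `s` as well as in `t`. -/
structure EvolutionCurves (u u' u'' ψ ψ' : ℝ → X) (v v' q q' R : ℝ → V) (I : ℝ → ℝ) : Prop where
  deriv_u : ∀ t, 0 < t → HasDerivAt u (u' t) t
  deriv_u' : ∀ t, 0 < t → HasDerivAt u' (u'' t) t
  deriv_ψ : ∀ t, 0 < t → HasDerivAt ψ (ψ' t) t
  deriv_v : ∀ t, 0 < t → HasDerivAt v (v' t) t
  deriv_q : ∀ t, 0 < t → HasDerivAt q (q' t) t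
  weak : ∀ t, 0 < t → ∀ s, 0 < s →
    inner ℝ (u' t + ψ t) (u s) = - inner ℝ (R t) (v s - q s)
  cocoercive : ∀ t, 0 < t → ∀ s, 0 < s → ‖R s - R t‖ ^ 2 ≤ inner ℝ (R s - R t) (v s - v t)
  convex : ∀ t, 0 < t → ∀ s, 0 < s → 2 * inner ℝ (R t) (v s - v t) ≤ I s - I t
  norm_sq_le : ∀ t, 0 < t → ‖R t‖ ^ 2 ≤ inner ℝ (R t) (v t)
  inner_le : ∀ t, 0 < t → inner ℝ (R t) (v t) ≤ I t
  le_inner : ∀ t, 0 < t → I t ≤ 2 * inner ℝ (R t) (v t)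

namespace EvolutionCurves

variable {u u' u'' ψ ψ' : ℝ → X} {v v' q q' R : ℝ → V} {I : ℝ → ℝ}

/-- The weak formulation tested with `p̄_t`. -/
theorem weak_deriv (h : EvolutionCurves u u' u'' ψ ψ' v v' q q' R I) {t s : ℝ} (ht : 0 < t)
    (hs : 0 < s) : inner ℝ (u' t + ψ t) (u' s) = - inner ℝ (R t) (v' s - q' s) := by
  have h1 : HasDerivAt (fun s => inner ℝ (u' t + ψ t) (u s)) (inner ℝ (u' t + ψ t) (u' s)) s := by
    simpa using (hasDerivAt_const s (u' t + ψ t)).inner ℝ (h.deriv_u s hs)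
  have h2 : HasDerivAt (fun s => - inner ℝ (R t) (v s - q s))
      (- inner ℝ (R t) (v' s - q' s)) s := by
    simpa using ((hasDerivAt_const s (R t)).inner ℝ ((h.deriv_v s hs).sub (h.deriv_q s hs))).fun_neg
  refine h1.unique (h2.congr_of_eventuallyEq ?_)
  filter_upwards [lt_mem_nhds hs] with r hr using h.weak t ht r hr

theorem norm_R_sub_le (h : EvolutionCurves u u' u'' ψ ψ' v v' q q' R I) {t s : ℝ} (ht : 0 < t)
    (hs : 0 < s) : ‖R s - R t‖ ≤ ‖v s - v t‖ := by
  have h1 := (h.cocoercive t ht s hs).trans (real_inner_le_norm _ _)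
  rcases (norm_nonneg (R s - R t)).eq_or_lt with h0 | h0
  · rw [← h0]; exact norm_nonneg _
  · rw [sq] at h1; exact le_of_mul_le_mul_left h1 h0

/-- `d/dt ∫ H(x, |∇p|) = 2 ∫ K ∇p · ∇p_t`: convexity bounds the increment of the energy from both
sides, and the two bounds differ by `O(|v(s) - v(t)|²)`. -/
theorem hasDerivAt_energy (h : EvolutionCurves u u' u'' ψ ψ' v v' q q' R I) {t : ℝ} (ht : 0 < t) :
    HasDerivAt I (2 * inner ℝ (R t) (v' t)) t := by
  have hv := h.deriv_v t ht
  have hlin : HasDerivAt (fun s => 2 * inner ℝ (R t) (v s - v t)) (2 * inner ℝ (R t) (v' t)) t := by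
    simpa using (((hasDerivAt_const t (R t)).inner ℝ (hv.sub_const (v t)))).const_mul 2
  have hsq : HasDerivAt (fun s => 2 * ‖v s - v t‖ ^ 2) 0 t := by
    simpa using (hv.sub_const (v t)).norm_sq.const_mul 2
  have hrem : HasDerivAt (fun s => I s - I t - 2 * inner ℝ (R t) (v s - v t)) 0 t := by
    rw [hasDerivAt_iff_isLittleO] at hsq ⊢
    simp only [sub_self, norm_zero, inner_zero_right, smul_zero, sub_zero, mul_zero, ne_eq,
      OfNat.ofNat_ne_zero, not_false_eq_true, zero_pow] at hsq ⊢
    refine (Asymptotics.IsBigO.of_bound 1 ?_).trans_isLittleO hsq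
    filter_upwards [lt_mem_nhds ht] with s hs
    have h1 := h.convex t ht s hs
    have h2 := h.convex s hs t ht
    have h3 := h.norm_R_sub_le ht hs
    have h4 : 2 * inner ℝ (R s - R t) (v s - v t) ≤ 2 * ‖v s - v t‖ ^ 2 := by
      have := real_inner_le_norm (R s - R t) (v s - v t)
      nlinarith [norm_nonneg (v s - v t)]
    have h5 : inner ℝ (R s) (v t - v s) = - inner ℝ (R s - R t) (v s - v t)
        - inner ℝ (R t) (v s - v t) := by
      rw [← neg_sub (v s) (v t), inner_neg_right, inner_sub_left]; ring
    rw [one_mul, Real.norm_of_nonneg (by linarith), Real.norm_of_nonneg (by positivity)]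
    linarith
  have := hrem.add hlin
  simp only [zero_add] at this
  refine (this.add_const (I t)).congr_of_eventuallyEq (Eventually.of_forall fun s => ?_)
  simp

theorem hasDerivAt_norm_sq (h : EvolutionCurves u u' u'' ψ ψ' v v' q q' R I) {t : ℝ}
    (ht : 0 < t) : HasDerivAt (fun s => ‖u s‖ ^ 2) (2 * inner ℝ (u t) (u' t)) t :=
  (h.deriv_u t ht).norm_sq

/-- The energy inequality obtained by testing with `p̄`, before the term in `Ψ_t` is absorbed. -/
theorem inner_deriv_le (h : EvolutionCurves u u' u'' ψ ψ' v v' q q' R I) {t : ℝ}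
    (ht : 0 < t) : 2 * inner ℝ (u t) (u' t) ≤
      - inner ℝ (R t) (v t) + ‖q t‖ ^ 2 + 2 * ‖ψ t‖ * ‖u t‖ := by
  have h1 := h.weak t ht t ht
  have h2 := h.norm_sq_le t ht
  rw [inner_add_left, inner_sub_right, real_inner_comm] at h1
  have h3 := abs_le.1 (abs_real_inner_le_norm (ψ t) (u t))
  have h4 := real_inner_le_norm (R t) (q t)
  nlinarith [sq_nonneg (‖R t‖ - ‖q t‖)]

/-- The energy inequality obtained by testing with `p̄_t`. -/
theorem energy_deriv_le (h : EvolutionCurves u u' u'' ψ ψ' v v' q q' R I) {t : ℝ}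
    (ht : 0 < t) : 2 * inner ℝ (R t) (v' t) ≤
      - ‖u' t‖ ^ 2 + I t + ‖ψ t‖ ^ 2 + ‖q' t‖ ^ 2 := by
  have h1 := h.weak_deriv ht ht
  have h2 := (h.norm_sq_le t ht).trans (h.inner_le t ht)
  rw [inner_add_left, inner_sub_right, real_inner_self_eq_norm_sq] at h1
  have h3 := abs_le.1 (abs_real_inner_le_norm (ψ t) (u' t))
  have h4 := real_inner_le_norm (R t) (q' t)
  nlinarith [sq_nonneg (‖R t‖ - ‖q' t‖), sq_nonneg (‖ψ t‖ - ‖u' t‖)]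

/-- Differentiation of the weak formulation in `t`. The difference quotients `A` of the flux and
`D` of the gradient satisfy `|A|² ≤ ⟨A, D⟩`, whence `-⟨A, ∇p̄_t⟩ ≤ |∇Ψ_t|² / 4` in the limit;
differentiability of the flux is not needed. -/
theorem inner_second_deriv_le (h : EvolutionCurves u u' u'' ψ ψ' v v' q q' R I) {t : ℝ}
    (ht : 0 < t) : inner ℝ (u'' t + ψ' t) (u' t) ≤ ‖q' t‖ ^ 2 / 4 := by
  have hd : HasDerivAt (fun τ => inner ℝ (u' τ + ψ τ) (u' t))
      (inner ℝ (u'' t + ψ' t) (u' t)) t := by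
    simpa using ((h.deriv_u' t ht).add (h.deriv_ψ t ht)).inner ℝ (hasDerivAt_const t (u' t))
  have hs1 := hasDerivAt_iff_tendsto_slope.1 hd
  have hs2 := hasDerivAt_iff_tendsto_slope.1 (h.deriv_v t ht)
  have hlim : Tendsto (fun s => (‖q' t‖ + ‖slope v t s - v' t‖) ^ 2 / 4) (𝓝[≠] t)
      (𝓝 ((‖q' t‖ + ‖v' t - v' t‖) ^ 2 / 4)) :=
    (((tendsto_const_nhds).add (hs2.sub_const (v' t)).norm).pow 2).div_const 4
  rw [sub_self, norm_zero, add_zero] at hlim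
  refine le_of_tendsto_of_tendsto hs1 hlim ?_
  filter_upwards [nhdsWithin_le_nhds (lt_mem_nhds ht), self_mem_nhdsWithin] with s hs hst
  have e1 : slope (fun τ => inner ℝ (u' τ + ψ τ) (u' t)) t s
      = - inner ℝ (slope R t s) (v' t - q' t) := by
    simp only [slope_def_field, slope_def_module, h.weak_deriv hs ht, h.weak_deriv ht ht,
      real_inner_smul_left, inner_sub_left]
    ring
  have e2 : ‖slope R t s‖ ^ 2 ≤ inner ℝ (slope R t s) (slope v t s) := by
    simp only [slope_def_module, real_inner_smul_left, real_inner_smul_right, norm_smul, mul_pow,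
      Real.norm_eq_abs, sq_abs]
    have := mul_le_mul_of_nonneg_left (h.cocoercive t ht s hs) (sq_nonneg (s - t)⁻¹)
    linarith
  rw [e1]
  set A := slope R t s
  set D := slope v t s
  have e3 : - inner ℝ A (v' t - q' t) =
      - inner ℝ A D + inner ℝ A (D - v' t) + inner ℝ A (q' t) := by
    simp only [inner_sub_right]; ring
  have e4 := real_inner_le_norm A (D - v' t)
  have e5 := real_inner_le_norm A (q' t)
  nlinarith [sq_nonneg (‖A‖ - (‖q' t‖ + ‖D - v' t‖) / 2)]

/-- The energy inequality for the time derivative of the equation, tested with `p̄_t`. -/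
theorem norm_sq_deriv_le (h : EvolutionCurves u u' u'' ψ ψ' v v' q q' R I) {t : ℝ}
    (ht : 0 < t) : 2 * inner ℝ (u' t) (u'' t) ≤
      ‖u' t‖ ^ 2 / 2 + ‖q' t‖ ^ 2 / 2 + 2 * ‖ψ' t‖ ^ 2 := by
  have h1 := h.inner_second_deriv_le ht
  rw [inner_add_left, real_inner_comm] at h1
  have h3 := abs_le.1 (abs_real_inner_le_norm (ψ' t) (u' t))
  nlinarith [sq_nonneg (2 * ‖ψ' t‖ - ‖u' t‖)]

end EvolutionCurves

end Hilbert

/-! ### Differential inequalities -/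

theorem add_rpow_le {x y s : ℝ} (hx : 0 ≤ x) (hy : 0 ≤ y) (hs : 0 ≤ s) (hs2 : s ≤ 2) :
    (x + y) ^ s ≤ 4 * (x ^ s + y ^ s) := by
  have hmax : x + y ≤ 2 * max x y := by linarith [le_max_left x y, le_max_right x y]
  have h4 : (2 : ℝ) ^ s ≤ 4 := by
    calc (2 : ℝ) ^ s ≤ 2 ^ (2 : ℝ) := Real.rpow_le_rpow_of_exponent_le (by norm_num) hs2
      _ = 4 := by norm_num
  have h5 : max x y ^ s ≤ x ^ s + y ^ s := by
    have p1 : 0 ≤ x ^ s := by positivity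
    have p2 : 0 ≤ y ^ s := by positivity
    rcases max_choice x y with hh | hh <;> rw [hh] <;> linarith
  calc (x + y) ^ s ≤ (2 * max x y) ^ s := by gcongr
    _ = 2 ^ s * max x y ^ s := Real.mul_rpow (by norm_num) (hx.trans (le_max_left _ _))
    _ ≤ _ := by gcongr

theorem le_add_integral_of_deriv_le {f φ : ℝ → ℝ} {s t : ℝ} (hst : s ≤ t)
    (hφ : ContinuousOn φ (Icc s t))
    (hf : ∀ τ ∈ Icc s t, ∃ d, HasDerivAt f d τ ∧ d ≤ φ τ) :
    f t ≤ f s + ∫ τ in s..t, φ τ := by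
  have h := intervalIntegral.sub_le_integral_of_hasDeriv_right_of_le (g := f) (g' := deriv f) hst
    (fun τ hτ => by
      obtain ⟨d, hd, -⟩ := hf τ hτ
      exact hd.continuousAt.continuousWithinAt)
    (fun τ hτ => by
      obtain ⟨d, hd, -⟩ := hf τ (Ioo_subset_Icc_self hτ)
      rw [hd.deriv]; exact hd.hasDerivWithinAt)
    hφ.integrableOn_Icc
    (fun τ hτ => by
      obtain ⟨d, hd, hle⟩ := hf τ (Ioo_subset_Icc_self hτ)
      rwa [hd.deriv])
  linarith

/-- Barrier argument: a function that decreases wherever it vanishes stays `≤ 0`. -/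
theorem nonpos_of_deriv_neg {w : ℝ → ℝ} {s t : ℝ} (hst : s ≤ t)
    (hw : ∀ τ ∈ Icc s t, ∃ d, HasDerivAt w d τ ∧ (w τ = 0 → d < 0)) (h0 : w s ≤ 0) : w t ≤ 0 := by
  refine image_le_of_deriv_right_lt_deriv_boundary (f := w) (f' := deriv w) (B := fun _ => 0)
    (B' := fun _ => 0) ?_ ?_ h0 (fun τ => hasDerivAt_const τ 0) ?_ (right_mem_Icc.2 hst)
  · intro τ hτ
    obtain ⟨d, hd, -⟩ := hw τ hτ
    exact hd.continuousAt.continuousWithinAt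
  · intro τ hτ
    obtain ⟨d, hd, -⟩ := hw τ (Ico_subset_Icc_self hτ)
    rw [hd.deriv]; exact hd.hasDerivWithinAt
  · intro τ hτ h
    obtain ⟨d, hd, hlt⟩ := hw τ (Ico_subset_Icc_self hτ)
    rw [hd.deriv]; exact hlt h

/-- A function that decreases at unit rate wherever it is nonnegative is eventually `≤ 0`. -/
theorem eventually_nonpos_of_deriv_le {w : ℝ → ℝ}
    (hw : ∀ᶠ τ in atTop, ∃ d, HasDerivAt w d τ ∧ (0 ≤ w τ → d ≤ -1)) :
    ∀ᶠ t in atTop, w t ≤ 0 := by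
  obtain ⟨T, hT⟩ := eventually_atTop.1 hw
  have hex : ∃ s, T ≤ s ∧ w s ≤ 0 := by
    by_contra! hcon
    set t := T + w T + 1
    have htT : T ≤ t := by have := hcon T le_rfl; simp only [t]; linarith
    have h := le_add_integral_of_deriv_le (f := w) (φ := fun _ => -1) htT continuousOn_const
      fun τ hτ => by
        obtain ⟨d, hd, hle⟩ := hT τ hτ.1
        exact ⟨d, hd, hle (hcon τ hτ.1).le⟩
    rw [intervalIntegral.integral_const, smul_eq_mul] at h
    have := hcon t htT
    simp only [t] at h this
    linarith
  obtain ⟨s, hTs, hs⟩ := hex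
  filter_upwards [eventually_ge_atTop s] with t ht
  refine nonpos_of_deriv_neg ht (fun τ hτ => ?_) hs
  obtain ⟨d, hd, hle⟩ := hT τ (hTs.trans hτ.1)
  exact ⟨d, hd, fun h => (hle h.ge).trans_lt (by norm_num)⟩

/-- The differential inequalities, with `r = 2 - a`, between `y = ∫ p̄² φ`, `z = ∫ p̄_t² φ`,
`I = ∫ H(x, |∇p|)` and the data `Γ`, `g₁`, `g₂`, which stand for `G`, `G₁`, `G₂`. -/
structure EnergyInequalities (r c : ℝ) (y z I Γ g₁ g₂ : ℝ → ℝ) : Prop where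
  y_nonneg : ∀ t, 0 ≤ t → 0 ≤ y t
  z_nonneg : ∀ t, 0 ≤ t → 0 ≤ z t
  I_nonneg : ∀ t, 0 ≤ t → 0 ≤ I t
  g₁_nonneg : ∀ t, 0 ≤ t → 0 ≤ g₁ t
  g₂_nonneg : ∀ t, 0 ≤ t → 0 ≤ g₂ t
  one_le : ∀ t, 0 ≤ t → 1 ≤ Γ t
  cont_y : ContinuousOn y (Ici 0)
  cont_I : ContinuousOn I (Ici 0)
  cont_Γ : ContinuousOn Γ (Ici 0)
  cont_g₁ : ContinuousOn g₁ (Ici 0)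
  cont_g₂ : ContinuousOn g₂ (Ici 0)
  deriv_y : ∀ t, 0 < t → ∃ d, HasDerivAt y d t ∧ d ≤ - I t / 4 + c * Γ t ∧ d ^ 2 ≤ 4 * (y t * z t)
  deriv_I : ∀ t, 0 < t → ∃ d, HasDerivAt I d t ∧ d ≤ - z t + I t + Γ t + g₁ t
  deriv_z : ∀ t, 0 < t → ∃ d, HasDerivAt z d t ∧ d ≤ z t / 2 + g₁ t / 2 + 2 * g₂ t
  poincare : ∀ t, 0 < t → y t ^ (r / 2) ≤ c * (I t + Γ t)

namespace EnergyInequalities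

variable {r c : ℝ} {y z I Γ g₁ g₂ : ℝ → ℝ}

theorem continuousOn_data (h : EnergyInequalities r c y z I Γ g₁ g₂) :
    ContinuousOn (fun τ => g₁ τ + g₂ τ) (Ici 0) := h.cont_g₁.add h.cont_g₂

theorem integral_data_mono (h : EnergyInequalities r c y z I Γ g₁ g₂) {s₀ s t : ℝ}
    (h0 : 0 ≤ s₀) (hs : s₀ ≤ s) (hst : s ≤ t) :
    ∫ τ in s..t, (g₁ τ + g₂ τ) ≤ ∫ τ in s₀..t, (g₁ τ + g₂ τ) := by
  refine intervalIntegral.integral_mono_interval hs hst le_rfl ?_ ?_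
  · refine (ae_restrict_iff' measurableSet_Ioc).2 (Eventually.of_forall fun τ hτ => ?_)
    have := h.g₁_nonneg τ (h0.trans hτ.1.le)
    have := h.g₂_nonneg τ (h0.trans hτ.1.le)
    simp only [Pi.zero_apply]
    linarith
  · refine (h.continuousOn_data.mono ?_).intervalIntegrable
    rw [uIcc_of_le (hs.trans hst)]
    exact fun τ hτ => h0.trans hτ.1

/-- A bound for `∫ p̄_t² φ` at time `t` in terms of `∫ p̄² φ` half a time unit before. In the
functional `(τ - s)² z + (5/2)(τ - s) I + 20 y` the bad terms of each summand are absorbed by the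
good term of the next one. -/
theorem z_le (h : EnergyInequalities r c y z I Γ g₁ g₂) (hc : 1 ≤ c) {t m : ℝ} (ht : 1 ≤ t)
    (hm : ∀ τ ∈ Icc (t - 1 / 2) t, Γ τ ≤ m) :
    z t ≤ 80 * y (t - 1 / 2) + 46 * c * m + 12 * ∫ τ in (t - 1)..t, (g₁ τ + g₂ τ) := by
  set s := t - 1 / 2 with hs
  have hs0 : 0 < s := by linarith
  have hst : s ≤ t := by linarith
  have hcont : ContinuousOn (fun τ => g₁ τ + g₂ τ) (Icc s t) :=
    h.continuousOn_data.mono fun τ hτ => hs0.le.trans hτ.1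
  have key := le_add_integral_of_deriv_le
    (f := fun τ => (τ - s) ^ 2 * z τ + 5 / 2 * (τ - s) * I τ + 20 * y τ)
    (φ := fun τ => 23 * c * m + 3 * (g₁ τ + g₂ τ)) hst
    (continuousOn_const.add (continuousOn_const.mul hcont)) (fun τ hτ => by
      have hτ0 : 0 < τ := hs0.trans_le hτ.1
      obtain ⟨dy, hdy, hdy1, -⟩ := h.deriv_y τ hτ0
      obtain ⟨dI, hdI, hdI1⟩ := h.deriv_I τ hτ0
      obtain ⟨dz, hdz, hdz1⟩ := h.deriv_z τ hτ0
      have hσ : HasDerivAt (fun τ => τ - s) 1 τ := (hasDerivAt_id τ).sub_const s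
      refine ⟨_, (((hσ.fun_pow 2).mul hdz).add ((hσ.const_mul (5 / 2)).mul hdI)).add
        (hdy.const_mul 20), ?_⟩
      have hΓ := hm τ hτ
      have hΓ1 := h.one_le τ hτ0.le
      have hz := h.z_nonneg τ hτ0.le
      have hI := h.I_nonneg τ hτ0.le
      have hg1 := h.g₁_nonneg τ hτ0.le
      have hg2 := h.g₂_nonneg τ hτ0.le
      have hσ0 : 0 ≤ τ - s := sub_nonneg.2 hτ.1
      have hσ1 : τ - s ≤ 1 / 2 := by have := hτ.2; linarith
      generalize τ - s = σ at *
      have hσ2 : σ ^ 2 ≤ σ / 2 := by nlinarith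
      have e1 := mul_le_mul_of_nonneg_left hdz1 (sq_nonneg σ)
      have e2 := mul_le_mul_of_nonneg_left hdI1 hσ0
      have e3 := mul_le_mul_of_nonneg_right hσ2 hz
      have e3' := mul_le_mul_of_nonneg_right hσ2 hg1
      have e3'' := mul_le_mul_of_nonneg_right hσ2 hg2
      have e4 := mul_le_mul_of_nonneg_right hσ1 hI
      have e5 := mul_le_mul_of_nonneg_right hσ1 hg1
      have e5' := mul_le_mul_of_nonneg_right hσ1 hg2
      have e6 := mul_le_mul_of_nonneg_right hσ1 (zero_le_one.trans hΓ1)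
      have e7 := mul_le_mul_of_nonneg_right hc (zero_le_one.trans hΓ1)
      have e8 := mul_le_mul_of_nonneg_left hΓ (zero_le_one.trans hc)
      have e9 := mul_nonneg hσ0 hz
      push_cast
      nlinarith)
  have hsplit : ∫ τ in s..t, (23 * c * m + 3 * (g₁ τ + g₂ τ)) =
      23 * c * m / 2 + 3 * ∫ τ in s..t, (g₁ τ + g₂ τ) := by
    rw [intervalIntegral.integral_add, intervalIntegral.integral_const,
      intervalIntegral.integral_const_mul, smul_eq_mul]
    · rw [hs]; ring
    · exact intervalIntegrable_const
    · refine ((hcont.mono ?_).intervalIntegrable).const_mul 3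
      rw [uIcc_of_le hst]
  have hmono := h.integral_data_mono (s₀ := t - 1) (by linarith) (by linarith) hst
  have hI := h.I_nonneg t (by linarith)
  have hy := h.y_nonneg t (by linarith)
  rw [hsplit] at key
  have hts : t - s = 1 / 2 := by rw [hs]; ring
  simp only [hts, sub_self] at key
  linarith

/-- A bound for `I + z` at a time `t₀ ≤ 1` in terms of the initial values of `I` and `y`. -/
theorem I_add_z_le_initial (h : EnergyInequalities r c y z I Γ g₁ g₂) (hc : 1 ≤ c) {t₀ m : ℝ}
    (h0 : 0 < t₀) (h1 : t₀ ≤ 1) (hm : ∀ τ ∈ Icc 0 t₀, Γ τ ≤ m) :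
    I t₀ + z t₀ ≤ t₀⁻¹ * (6 * (I 0 + y 0) + 2 * ∫ τ in (0 : ℝ)..t₀, g₁ τ) + 8 * c * m
      + 2 * ∫ τ in (0 : ℝ)..t₀, g₂ τ := by
  have hint : ∀ {g : ℝ → ℝ}, ContinuousOn g (Ici 0) → ∀ {s}, 0 ≤ s → s ≤ t₀ →
      IntervalIntegrable g volume s t₀ := fun hg s hs hst =>
    (hg.mono (by rw [uIcc_of_le hst]; exact fun τ hτ => hs.trans hτ.1)).intervalIntegrable
  have hm0 : 1 ≤ m := (h.one_le 0 le_rfl).trans (hm 0 ⟨le_rfl, h0.le⟩)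
  have hmono : ∀ {g : ℝ → ℝ}, ContinuousOn g (Ici 0) → (∀ t, 0 ≤ t → 0 ≤ g t) →
      ∀ {s}, 0 ≤ s → s ≤ t₀ → ∫ τ in s..t₀, g τ ≤ ∫ τ in (0 : ℝ)..t₀, g τ := by
    intro g hg hg0 s hs hst
    refine intervalIntegral.integral_mono_interval hs hst le_rfl ?_ (hint hg le_rfl h0.le)
    exact (ae_restrict_iff' measurableSet_Ioc).2 (Eventually.of_forall fun τ hτ => hg0 τ hτ.1.le)
  -- the estimate from time `s > 0` to `t₀`; afterwards `s → 0`
  have key : ∀ s ∈ Ioc 0 t₀, (t₀ - s) * z t₀ + 3 / 2 * I t₀ + 6 * y t₀ ≤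
      3 / 2 * I s + 6 * y s + (8 * c * m * t₀ + 2 * (∫ τ in (0 : ℝ)..t₀, g₁ τ)
        + 2 * t₀ * ∫ τ in (0 : ℝ)..t₀, g₂ τ) := by
    intro s hs
    have hsub : Icc s t₀ ⊆ Ici 0 := fun τ hτ => hs.1.le.trans hτ.1
    have hk := le_add_integral_of_deriv_le
      (f := fun τ => (τ - s) * z τ + 3 / 2 * I τ + 6 * y τ)
      (φ := fun τ => 8 * c * m + 2 * g₁ τ + 2 * t₀ * g₂ τ) hs.2
      ((continuousOn_const.add (continuousOn_const.mul (h.cont_g₁.mono hsub))).add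
        (continuousOn_const.mul (h.cont_g₂.mono hsub))) (fun τ hτ => by
        have hτ0 : 0 < τ := hs.1.trans_le hτ.1
        obtain ⟨dy, hdy, hdy1, -⟩ := h.deriv_y τ hτ0
        obtain ⟨dI, hdI, hdI1⟩ := h.deriv_I τ hτ0
        obtain ⟨dz, hdz, hdz1⟩ := h.deriv_z τ hτ0
        have hσ : HasDerivAt (fun τ => τ - s) 1 τ := (hasDerivAt_id τ).sub_const s
        refine ⟨_, ((hσ.mul hdz).add (hdI.const_mul (3 / 2))).add (hdy.const_mul 6), ?_⟩
        have hΓ := hm τ ⟨hτ0.le, hτ.2⟩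
        have hΓ1 := h.one_le τ hτ0.le
        have hz := h.z_nonneg τ hτ0.le
        have hg1 := h.g₁_nonneg τ hτ0.le
        have hg2 := h.g₂_nonneg τ hτ0.le
        have hσ0 : 0 ≤ τ - s := sub_nonneg.2 hτ.1
        have hσ1 : τ - s ≤ t₀ := by have := hτ.2; have := hs.1; linarith
        generalize τ - s = σ at *
        have e1 := mul_le_mul_of_nonneg_left hdz1 hσ0
        have e2 := mul_le_mul_of_nonneg_right (hσ1.trans h1) hz
        have e3 := mul_le_mul_of_nonneg_right (hσ1.trans h1) hg1
        have e4 := mul_le_mul_of_nonneg_right hσ1 hg2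
        have e7 := mul_le_mul_of_nonneg_right hc (zero_le_one.trans hΓ1)
        have e8 := mul_le_mul_of_nonneg_left hΓ (zero_le_one.trans hc)
        nlinarith)
    have i1 := hint h.cont_g₁ hs.1.le hs.2
    have i2 := hint h.cont_g₂ hs.1.le hs.2
    rw [intervalIntegral.integral_add (intervalIntegrable_const.add (i1.const_mul 2))
        (i2.const_mul _), intervalIntegral.integral_add intervalIntegrable_const (i1.const_mul 2),
      intervalIntegral.integral_const, intervalIntegral.integral_const_mul,
      intervalIntegral.integral_const_mul, smul_eq_mul] at hk
    have j1 := hmono h.cont_g₁ h.g₁_nonneg hs.1.le hs.2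
    have j2 := mul_le_mul_of_nonneg_left (hmono h.cont_g₂ h.g₂_nonneg hs.1.le hs.2) h0.le
    have j3 : (t₀ - s) * (8 * c * m) ≤ t₀ * (8 * c * m) :=
      mul_le_mul_of_nonneg_right (by have := hs.1; linarith) (by nlinarith)
    simp only [sub_self, zero_mul, zero_add] at hk
    linarith
  have hmem : Ioc 0 t₀ ∈ 𝓝[>] (0 : ℝ) := Ioc_mem_nhdsGT h0
  have hIlim : Tendsto I (𝓝[>] 0) (𝓝 (I 0)) :=
    (h.cont_I 0 self_mem_Ici).mono_left (nhdsWithin_mono _ Ioi_subset_Ici_self)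
  have hylim : Tendsto y (𝓝[>] 0) (𝓝 (y 0)) :=
    (h.cont_y 0 self_mem_Ici).mono_left (nhdsWithin_mono _ Ioi_subset_Ici_self)
  have hslim : Tendsto (fun s : ℝ => s) (𝓝[>] 0) (𝓝 0) := nhdsWithin_le_nhds
  have hlim := le_of_tendsto_of_tendsto
    ((((hslim.const_sub t₀).mul_const (z t₀)).add_const (3 / 2 * I t₀)).add_const (6 * y t₀))
    (((hIlim.const_mul (3 / 2)).add (hylim.const_mul 6)).add_const
      (8 * c * m * t₀ + 2 * (∫ τ in (0 : ℝ)..t₀, g₁ τ) + 2 * t₀ * ∫ τ in (0 : ℝ)..t₀, g₂ τ))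
    (by filter_upwards [hmem] with s hs using key s hs)
  have hI0 := h.I_nonneg 0 le_rfl
  have hI := h.I_nonneg t₀ h0.le
  have hy := h.y_nonneg t₀ h0.le
  have e : t₀ * (I t₀ + z t₀) ≤ t₀ * (t₀⁻¹ * (6 * (I 0 + y 0) + 2 * ∫ τ in (0 : ℝ)..t₀, g₁ τ)
      + 8 * c * m + 2 * ∫ τ in (0 : ℝ)..t₀, g₂ τ) := by
    rw [mul_add t₀ _ (2 * _), mul_add t₀ (t₀⁻¹ * _), mul_inv_cancel_left₀ h0.ne']
    have := mul_le_mul_of_nonneg_right h1 hI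
    linarith
  exact le_of_mul_le_mul_left e h0

/-- Elimination of `I` from the inequality for `y'` by means of the Poincaré inequality. -/
theorem deriv_y_le (h : EnergyInequalities r c y z I Γ g₁ g₂) (hc : 1 ≤ c) {t : ℝ} (ht : 0 < t) :
    ∃ d, HasDerivAt y d t ∧ d ≤ - y t ^ (r / 2) / (4 * c) + 2 * c * Γ t := by
  obtain ⟨d, hd, hd1, -⟩ := h.deriv_y t ht
  refine ⟨d, hd, hd1.trans ?_⟩
  have h1 := h.poincare t ht
  have h2 := h.one_le t ht.le
  have h3 : y t ^ (r / 2) / (4 * c) ≤ (I t + Γ t) / 4 := by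
    rw [div_le_iff₀ (by linarith)]; linarith
  have h4 := mul_le_mul_of_nonneg_right hc (zero_le_one.trans h2)
  rw [neg_div, neg_div]
  linarith

/-- If `y ≥ (16 c² m)^{2/r}` then the dissipation `y^{r/2} / (4c)` is at least `4 c m`. -/
theorem deriv_y_le_of_ge (h : EnergyInequalities r c y z I Γ g₁ g₂) (hc : 1 ≤ c) (hr : 1 < r)
    {t m : ℝ} (ht : 0 < t) (hm : 0 ≤ m) (hy : (16 * c ^ 2 * m) ^ (2 / r) ≤ y t) :
    ∃ d, HasDerivAt y d t ∧ d ≤ - (4 * c * m) + 2 * c * Γ t := by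
  obtain ⟨d, hd, hd1⟩ := h.deriv_y_le hc ht
  refine ⟨d, hd, hd1.trans ?_⟩
  have h0 : 0 ≤ 16 * c ^ 2 * m := by positivity
  have h1 := Real.rpow_le_rpow (Real.rpow_nonneg h0 _) hy (by linarith : 0 ≤ r / 2)
  rw [← Real.rpow_mul h0, show 2 / r * (r / 2) = 1 by field_simp, Real.rpow_one] at h1
  have h2 : 4 * c * m ≤ y t ^ (r / 2) / (4 * c) := by
    rw [le_div_iff₀ (by linarith)]; linarith
  rw [neg_div]
  linarith

theorem y_le_of_bound (h : EnergyInequalities r c y z I Γ g₁ g₂) (hc : 1 ≤ c) (hr : 1 < r)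
    {t m : ℝ} (ht : 0 ≤ t) (hm : ∀ τ ∈ Icc 0 t, Γ τ ≤ m) :
    y t ≤ y 0 + (16 * c ^ 2 * m) ^ (2 / r) := by
  rcases ht.eq_or_lt with rfl | ht
  · have := (h.one_le 0 le_rfl).trans (hm 0 ⟨le_rfl, le_rfl⟩)
    have : 0 ≤ (16 * c ^ 2 * m) ^ (2 / r) := by positivity
    linarith
  have hm1 : 1 ≤ m := (h.one_le 0 le_rfl).trans (hm 0 ⟨le_rfl, ht.le⟩)
  have hylim : Tendsto y (𝓝[>] 0) (𝓝 (y 0)) :=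
    (h.cont_y 0 self_mem_Ici).mono_left (nhdsWithin_mono _ Ioi_subset_Ici_self)
  refine ge_of_tendsto (hylim.add_const _) ?_
  filter_upwards [Ioc_mem_nhdsGT ht] with s hs
  refine sub_nonpos.1 (nonpos_of_deriv_neg
    (w := fun τ => y τ - (y s + (16 * c ^ 2 * m) ^ (2 / r))) hs.2 (fun τ hτ => ?_) ?_)
  · have hτ0 := hs.1.trans_le hτ.1
    by_cases hw : y τ - (y s + (16 * c ^ 2 * m) ^ (2 / r)) = 0
    · have hys := h.y_nonneg s hs.1.le
      obtain ⟨d, hd, hd1⟩ := h.deriv_y_le_of_ge hc hr (m := m) hτ0 (by linarith) (by linarith)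
      refine ⟨d, hd.sub_const _, fun _ => ?_⟩
      have := mul_le_mul_of_nonneg_left (hm τ ⟨hτ0.le, hτ.2⟩) (zero_le_one.trans hc)
      nlinarith
    · obtain ⟨d, hd, -⟩ := h.deriv_y τ hτ0
      exact ⟨d, hd.sub_const _, fun h => absurd h hw⟩
  · have : 0 ≤ (16 * c ^ 2 * m) ^ (2 / r) := by positivity
    simpa using this

theorem eventually_y_le_of_bound (h : EnergyInequalities r c y z I Γ g₁ g₂) (hc : 1 ≤ c)
    (hr : 1 < r) {m : ℝ} (hm : ∀ᶠ τ in atTop, Γ τ ≤ m) :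
    ∀ᶠ t in atTop, y t ≤ (16 * c ^ 2 * m) ^ (2 / r) := by
  refine (eventually_nonpos_of_deriv_le (w := fun τ => y τ - (16 * c ^ 2 * m) ^ (2 / r)) ?_).mono
    fun t ht => sub_nonpos.1 ht
  filter_upwards [hm, eventually_gt_atTop 0] with τ hτ hτ0
  by_cases hw : 0 ≤ y τ - (16 * c ^ 2 * m) ^ (2 / r)
  · have hm1 := (h.one_le τ hτ0.le).trans hτ
    obtain ⟨d, hd, hd1⟩ := h.deriv_y_le_of_ge hc hr (m := m) hτ0 (by linarith) (by linarith)
    refine ⟨d, hd.sub_const _, fun _ => ?_⟩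
    have := mul_le_mul_of_nonneg_left hτ (zero_le_one.trans hc)
    nlinarith
  · obtain ⟨d, hd, -⟩ := h.deriv_y τ hτ0
    exact ⟨d, hd.sub_const _, fun h => absurd h hw⟩

/-- When `Γ' ≥ -b` eventually, `(16 c² (Γ + β))^{2/r}` is a supersolution of the differential
inequality for `y`, provided that `β` is so large that
`2 (16 c²)² b (Γ + β)^{2/r - 1} ≤ Γ + β`. -/
theorem eventually_y_le_of_deriv (h : EnergyInequalities r c y z I Γ g₁ g₂) (hc : 1 ≤ c)
    (hr : 1 < r) (hr2 : r < 2) {b β : ℝ} (hb : 1 ≤ b)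
    (hβ : β = (2 * (16 * c ^ 2) ^ 2 * b) ^ (r / (2 * (r - 1))))
    (hΓ : ∀ᶠ τ in atTop, DifferentiableAt ℝ Γ τ ∧ - deriv Γ τ ≤ b) :
    ∀ᶠ t in atTop, y t ≤ (16 * c ^ 2 * (Γ t + β)) ^ (2 / r) := by
  have hβ0 : 0 ≤ β := by rw [hβ]; positivity
  refine (eventually_nonpos_of_deriv_le
    (w := fun τ => y τ - (16 * c ^ 2 * (Γ τ + β)) ^ (2 / r)) ?_).mono fun t ht => sub_nonpos.1 ht
  filter_upwards [hΓ, eventually_gt_atTop 0] with τ ⟨hτd, hτb⟩ hτ0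
  have hΓ1 := h.one_le τ hτ0.le
  set κ := 16 * c ^ 2 with hκ
  have hκ1 : 1 ≤ κ := by nlinarith
  have hpos : 0 < Γ τ + β := by linarith
  have hZ : HasDerivAt (fun τ => (κ * (Γ τ + β)) ^ (2 / r))
      (κ * deriv Γ τ * (2 / r) * (κ * (Γ τ + β)) ^ (2 / r - 1)) τ :=
    ((hτd.hasDerivAt.add_const β).const_mul κ).rpow_const (Or.inl (by positivity))
  by_cases hw : 0 ≤ y τ - (κ * (Γ τ + β)) ^ (2 / r)
  · obtain ⟨d, hd, hd1⟩ := h.deriv_y_le_of_ge hc hr (m := Γ τ + β) hτ0 hpos.le (by linarith)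
    refine ⟨_, hd.sub hZ, fun _ => ?_⟩
    have hexp : 0 ≤ 2 / r - 1 := by rw [sub_nonneg, le_div_iff₀ (by linarith)]; linarith
    have hexp1 : 2 / r - 1 ≤ 1 := by
      have : 2 / r ≤ 2 := by rw [div_le_iff₀ (by linarith)]; linarith
      linarith
    have hexp2 : 2 / r ≤ 2 := by linarith
    have e1 : (κ * (Γ τ + β)) ^ (2 / r - 1) ≤ κ * (Γ τ + β) ^ (2 / r - 1) := by
      rw [Real.mul_rpow (by linarith) hpos.le]
      gcongr
      nth_rewrite 2 [← Real.rpow_one κ]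
      exact Real.rpow_le_rpow_of_exponent_le hκ1 hexp1
    have e2 : 2 * κ ^ 2 * b ≤ (Γ τ + β) ^ (2 - 2 / r) := by
      have hB : 0 ≤ 2 * κ ^ 2 * b := by positivity
      calc 2 * κ ^ 2 * b = β ^ (2 - 2 / r) := by
            have hr1 : r - 1 ≠ 0 := by linarith
            rw [hβ, ← Real.rpow_mul hB, show r / (2 * (r - 1)) * (2 - 2 / r) = 1 by field_simp,
              Real.rpow_one]
        _ ≤ _ := Real.rpow_le_rpow hβ0 (by linarith) (by linarith)
    have e3 : (Γ τ + β) ^ (2 - 2 / r) * (Γ τ + β) ^ (2 / r - 1) = Γ τ + β := by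
      rw [← Real.rpow_add hpos, show 2 - 2 / r + (2 / r - 1) = 1 by ring, Real.rpow_one]
    have hP : 0 ≤ (Γ τ + β) ^ (2 / r - 1) := by positivity
    have e4 : - (κ * deriv Γ τ * (2 / r) * (κ * (Γ τ + β)) ^ (2 / r - 1)) ≤ Γ τ + β := by
      calc _ = κ * (- deriv Γ τ) * (2 / r) * (κ * (Γ τ + β)) ^ (2 / r - 1) := by ring
        _ ≤ κ * b * 2 * (κ * (Γ τ + β) ^ (2 / r - 1)) := by gcongr
        _ = 2 * κ ^ 2 * b * (Γ τ + β) ^ (2 / r - 1) := by ring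
        _ ≤ (Γ τ + β) ^ (2 - 2 / r) * (Γ τ + β) ^ (2 / r - 1) := by gcongr
        _ = _ := e3
    nlinarith
  · obtain ⟨d, hd, -⟩ := h.deriv_y τ hτ0
    exact ⟨_, hd.sub hZ, fun h => absurd h hw⟩

/-- Grönwall's inequality for `I + z`, whose decay rate is `1/4`. -/
theorem I_add_z_le_gronwall (h : EnergyInequalities r c y z I Γ g₁ g₂) {t₀ t m Y : ℝ}
    (hc : 1 ≤ c) (h0 : 0 < t₀) (htt : t₀ ≤ t) (hm : ∀ τ ∈ Icc t₀ t, Γ τ ≤ m)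
    (hY : ∀ τ ∈ Icc t₀ t, y τ ≤ Y) :
    I t + z t ≤ Real.exp (-(1 / 4) * (t - t₀)) * (I t₀ + z t₀) + 4 * (6 * c * m + 100 * Y)
      + 2 * ∫ τ in t₀..t, Real.exp (-(1 / 4) * (t - τ)) * (g₁ τ + g₂ τ) := by
  set Q := 6 * c * m + 100 * Y with hQ
  have hcont : ContinuousOn (fun τ => 2 * (Real.exp (-(1 / 4) * (t - τ)) * (g₁ τ + g₂ τ)))
      (Icc t₀ t) :=
    continuousOn_const.mul (ContinuousOn.mul (by fun_prop)
      (h.continuousOn_data.mono fun τ hτ => h0.le.trans hτ.1))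
  have hexp : ∀ τ, HasDerivAt (fun τ => Real.exp (-(1 / 4) * (t - τ)))
      (Real.exp (-(1 / 4) * (t - τ)) * (1 / 4)) τ := by
    intro τ
    have := (((hasDerivAt_id τ).const_sub t).const_mul (-(1 / 4) : ℝ)).exp
    simpa using this
  have key := le_add_integral_of_deriv_le
    (f := fun τ => Real.exp (-(1 / 4) * (t - τ)) * (I τ + z τ - 4 * Q)) htt hcont
    (fun τ hτ => by
      have hτ0 : 0 < τ := h0.trans_le hτ.1
      obtain ⟨dy, hdy, hdy1, hdy2⟩ := h.deriv_y τ hτ0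
      obtain ⟨dI, hdI, hdI1⟩ := h.deriv_I τ hτ0
      obtain ⟨dz, hdz, hdz1⟩ := h.deriv_z τ hτ0
      refine ⟨_, (hexp τ).mul ((hdI.add hdz).sub_const (4 * Q)), ?_⟩
      have hΓ := hm τ hτ
      have hΓ1 := h.one_le τ hτ0.le
      have hz := h.z_nonneg τ hτ0.le
      have hy := h.y_nonneg τ hτ0.le
      have hg1 := h.g₁_nonneg τ hτ0.le
      have hyY := hY τ hτ
      have hE := Real.exp_pos (-(1 / 4) * (t - τ))
      -- the term in `I` is controlled by `-y'`, and `|y'| ≤ 2 √(y z)`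
      have e1 : - (5 * dy) ≤ z τ / 4 + 100 * y τ := by
        have : (5 * dy) ^ 2 ≤ (z τ / 4 + 100 * y τ) ^ 2 := by
          nlinarith [sq_nonneg (z τ / 4 - 100 * y τ)]
        exact (abs_le.1 (abs_le_of_sq_le_sq this (by linarith))).1 |> fun h => by linarith
      have e7 := mul_le_mul_of_nonneg_right hc (zero_le_one.trans hΓ1)
      have e8 := mul_le_mul_of_nonneg_left hΓ (zero_le_one.trans hc)
      have e2 : 1 / 4 * (I τ + z τ - 4 * Q) + (dI + dz) ≤ 2 * (g₁ τ + g₂ τ) := by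
        rw [hQ]; linarith
      have := mul_le_mul_of_nonneg_left e2 hE.le
      linarith)
  rw [intervalIntegral.integral_const_mul] at key
  simp only [sub_self, mul_zero, Real.exp_zero, one_mul] at key
  have hm1 : 1 ≤ m := (h.one_le t₀ h0.le).trans (hm t₀ ⟨le_rfl, htt⟩)
  have hY0 : 0 ≤ Y := (h.y_nonneg t₀ h0.le).trans (hY t₀ ⟨le_rfl, htt⟩)
  have hQ0 : 0 ≤ Q := by rw [hQ]; positivity
  have := mul_nonneg (Real.exp_pos (-(1 / 4) * (t - t₀))).le hQ0
  linarith

/-- The bound of `I + z` by the initial values, a bound `m` of `Γ` and the data, with a constant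
that depends only on `r` and `c`. -/
theorem I_add_z_bound (hc : 1 ≤ c) (hr : 1 < r) (hr2 : r < 2) :
    ∃ C : ℝ, 0 < C ∧ ∀ {y z I Γ g₁ g₂ : ℝ → ℝ}, EnergyInequalities r c y z I Γ g₁ g₂ →
      ∀ {t₀ t m : ℝ}, 0 < t₀ → t₀ ≤ 1 → t₀ ≤ t → (∀ τ ∈ Icc 0 t, Γ τ ≤ m) →
      I t + z t ≤ C * (t₀⁻¹ * (I 0 + y 0) + t₀⁻¹ * (∫ τ in (0 : ℝ)..t₀, g₁ τ) + m ^ (2 / r)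
        + ∫ τ in (0 : ℝ)..t, Real.exp (-(1 / 4) * (t - τ)) * (g₁ τ + g₂ τ)) := by
  set D := (16 * c ^ 2) ^ (2 / r) with hD
  have hD0 : 0 ≤ D := by positivity
  refine ⟨406 + 32 * c + 400 * D, by positivity, ?_⟩
  intro y z I Γ g₁ g₂ h t₀ t m h0 h1 htt hm
  have ht0 : 0 < t := h0.trans_le htt
  have hm1 : 1 ≤ m := (h.one_le 0 le_rfl).trans (hm 0 ⟨le_rfl, ht0.le⟩)
  have hmr : m ≤ m ^ (2 / r) := by
    nth_rewrite 1 [← Real.rpow_one m]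
    refine Real.rpow_le_rpow_of_exponent_le hm1 ?_
    rw [le_div_iff₀ (by linarith)]; linarith
  have hini := h.I_add_z_le_initial hc h0 h1 fun τ hτ => hm τ ⟨hτ.1, hτ.2.trans htt⟩
  have hgr := h.I_add_z_le_gronwall (m := m) (Y := y 0 + (16 * c ^ 2 * m) ^ (2 / r)) hc h0 htt
    (fun τ hτ => hm τ ⟨h0.le.trans hτ.1, hτ.2⟩)
    (fun τ hτ => h.y_le_of_bound hc hr (h0.le.trans hτ.1)
      fun σ hσ => hm σ ⟨hσ.1, hσ.2.trans hτ.2⟩)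
  rw [Real.mul_rpow (by positivity) (by linarith), ← hD] at hgr
  have hE1 : Real.exp (-(1 / 4) * (t - t₀)) ≤ 1 := Real.exp_le_one_iff.2 (by linarith)
  have hE0 := Real.exp_pos (-(1 / 4) * (t - t₀))
  have hcont : ContinuousOn (fun τ => Real.exp (-(1 / 4) * (t - τ)) * (g₁ τ + g₂ τ)) (Ici 0) :=
    ContinuousOn.mul (by fun_prop) h.continuousOn_data
  have hint : ∀ {g : ℝ → ℝ} {s s' : ℝ}, ContinuousOn g (Ici 0) → 0 ≤ s → s ≤ s' →
      IntervalIntegrable g volume s s' := fun hg hs hst =>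
    (hg.mono (by rw [uIcc_of_le hst]; exact fun τ hτ => hs.trans hτ.1)).intervalIntegrable
  -- on `[0, t₀]` the factors `e^{-(t - τ)/4}` and `e^{-(t - t₀)/4}` are comparable
  have hg2 : Real.exp (-(1 / 4) * (t - t₀)) * (∫ τ in (0 : ℝ)..t₀, g₂ τ) ≤
      2 * ∫ τ in (0 : ℝ)..t₀, Real.exp (-(1 / 4) * (t - τ)) * (g₁ τ + g₂ τ) := by
    rw [← intervalIntegral.integral_const_mul, ← intervalIntegral.integral_const_mul]
    refine intervalIntegral.integral_mono_on h0.le ((hint h.cont_g₂ le_rfl h0.le).const_mul _)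
      ((hint hcont le_rfl h0.le).const_mul 2) fun τ hτ => ?_
    have e1 : Real.exp (-(1 / 4) * (t - t₀)) ≤ 2 * Real.exp (-(1 / 4) * (t - τ)) := by
      have e2 : Real.exp (-(1 / 4) * (t - t₀)) =
          Real.exp ((t₀ - τ) / 4) * Real.exp (-(1 / 4) * (t - τ)) := by
        rw [← Real.exp_add]; ring_nf
      have e3 : Real.exp ((t₀ - τ) / 4) ≤ 2 := by
        have h4 : (t₀ - τ) / 4 ≤ Real.log 2 := by
          have := Real.log_two_gt_d9
          have := hτ.1
          linarith
        calc _ ≤ Real.exp (Real.log 2) := Real.exp_le_exp.2 h4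
          _ = 2 := Real.exp_log two_pos
      rw [e2]
      exact mul_le_mul_of_nonneg_right e3 (Real.exp_pos _).le
    have h1 := h.g₁_nonneg τ hτ.1
    have h2 := h.g₂_nonneg τ hτ.1
    have h3 := Real.exp_pos (-(1 / 4) * (t - τ))
    nlinarith [mul_le_mul_of_nonneg_right e1 h2, mul_nonneg h3.le h1]
  have hadd := intervalIntegral.integral_add_adjacent_intervals (hint hcont le_rfl h0.le)
    (hint hcont h0.le htt)
  have hpos : ∀ {g : ℝ → ℝ} {s s' : ℝ}, s ≤ s' → (∀ τ ∈ Icc s s', 0 ≤ g τ) →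
      0 ≤ ∫ τ in s..s', g τ := fun hs hg => intervalIntegral.integral_nonneg hs hg
  have hJ1 : 0 ≤ ∫ τ in (0 : ℝ)..t₀, Real.exp (-(1 / 4) * (t - τ)) * (g₁ τ + g₂ τ) :=
    hpos h0.le fun τ hτ => mul_nonneg (Real.exp_pos _).le
      (add_nonneg (h.g₁_nonneg τ hτ.1) (h.g₂_nonneg τ hτ.1))
  have hJ2 : 0 ≤ ∫ τ in t₀..t, Real.exp (-(1 / 4) * (t - τ)) * (g₁ τ + g₂ τ) :=
    hpos htt fun τ hτ => mul_nonneg (Real.exp_pos _).le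
      (add_nonneg (h.g₁_nonneg τ (h0.le.trans hτ.1)) (h.g₂_nonneg τ (h0.le.trans hτ.1)))
  have hJ3 : 0 ≤ ∫ τ in (0 : ℝ)..t₀, g₁ τ := hpos h0.le fun τ hτ => h.g₁_nonneg τ hτ.1
  have hI0 := h.I_nonneg 0 le_rfl
  have hy0 := h.y_nonneg 0 le_rfl
  have hinv : 1 ≤ t₀⁻¹ := (one_le_inv₀ h0).2 h1
  rw [← hadd]
  generalize (∫ τ in (0 : ℝ)..t₀, Real.exp (-(1 / 4) * (t - τ)) * (g₁ τ + g₂ τ)) = J₁ at *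
  generalize (∫ τ in t₀..t, Real.exp (-(1 / 4) * (t - τ)) * (g₁ τ + g₂ τ)) = J₂ at *
  generalize (∫ τ in (0 : ℝ)..t₀, g₁ τ) = P at *
  generalize (∫ τ in (0 : ℝ)..t₀, g₂ τ) = S at *
  generalize Real.exp (-(1 / 4) * (t - t₀)) = E at *
  generalize m ^ (2 / r) = m' at *
  generalize I t + z t = L at *
  generalize I t₀ + z t₀ = L₀ at *
  generalize t₀⁻¹ = q at *
  have f1 := mul_le_mul_of_nonneg_left hini hE0.le
  have hA : 0 ≤ q * (6 * (I 0 + y 0) + 2 * P) + 8 * c * m := by positivity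
  have f2 := mul_le_mul_of_nonneg_right hE1 hA
  have f3 : y 0 ≤ q * (I 0 + y 0) := by nlinarith
  have f4 := mul_le_mul_of_nonneg_left hmr (zero_le_one.trans hc)
  have f5 : 0 ≤ q * (I 0 + y 0) := by positivity
  have f6 : 0 ≤ q * P := by positivity
  have hm'0 : 0 ≤ m' := by linarith
  have f7 : 0 ≤ c * (q * (I 0 + y 0) + q * P + J₁ + J₂) := by positivity
  have f8 : 0 ≤ D * (q * (I 0 + y 0) + q * P + J₁ + J₂) := by positivity
  have f9 : E * S ≤ 2 * J₁ := hg2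
  nlinarith

/-- The bound of `z` by the initial value of `y`, a bound `m` of `Γ` and the data over one time
unit. -/
theorem z_bound (hc : 1 ≤ c) (hr : 1 < r) (hr2 : r < 2) :
    ∃ C : ℝ, 0 < C ∧ ∀ {y z I Γ g₁ g₂ : ℝ → ℝ}, EnergyInequalities r c y z I Γ g₁ g₂ →
      ∀ {t m : ℝ}, 1 ≤ t → (∀ τ ∈ Icc 0 t, Γ τ ≤ m) →
      z t ≤ C * (y 0 + m ^ (2 / r) + ∫ τ in (t - 1)..t, (g₁ τ + g₂ τ)) := by
  set D := (16 * c ^ 2) ^ (2 / r) with hD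
  have hD0 : 0 ≤ D := by positivity
  refine ⟨80 + 46 * c + 80 * D, by positivity, ?_⟩
  intro y z I Γ g₁ g₂ h t m ht hm
  have hm1 : 1 ≤ m := (h.one_le 0 le_rfl).trans (hm 0 ⟨le_rfl, by linarith⟩)
  have hmr : m ≤ m ^ (2 / r) := by
    nth_rewrite 1 [← Real.rpow_one m]
    refine Real.rpow_le_rpow_of_exponent_le hm1 ?_
    rw [le_div_iff₀ (by linarith)]; linarith
  have hz := h.z_le hc ht fun τ hτ => hm τ ⟨by have := hτ.1; linarith, hτ.2⟩
  have hy := h.y_le_of_bound hc hr (t := t - 1 / 2) (by linarith)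
    fun τ hτ => hm τ ⟨hτ.1, by have := hτ.2; linarith⟩
  rw [Real.mul_rpow (by positivity) (by linarith), ← hD] at hy
  have hJ : 0 ≤ ∫ τ in (t - 1)..t, (g₁ τ + g₂ τ) :=
    intervalIntegral.integral_nonneg (by linarith) fun τ hτ =>
      add_nonneg (h.g₁_nonneg τ (by have := hτ.1; linarith))
        (h.g₂_nonneg τ (by have := hτ.1; linarith))
  have hy0 := h.y_nonneg 0 le_rfl
  have f4 := mul_le_mul_of_nonneg_left hmr (zero_le_one.trans hc)
  generalize (∫ τ in (t - 1)..t, (g₁ τ + g₂ τ)) = J at *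
  generalize m ^ (2 / r) = m' at *
  have f7 : 0 ≤ c * (y 0 + J) := by positivity
  have f8 : 0 ≤ D * (y 0 + J) := by positivity
  nlinarith

/-- For large times the bound of `z` is independent of the initial values. -/
theorem eventually_z_bound (hc : 1 ≤ c) (hr : 1 < r) (hr2 : r < 2) :
    ∃ C : ℝ, 0 < C ∧ ∀ {y z I Γ g₁ g₂ : ℝ → ℝ}, EnergyInequalities r c y z I Γ g₁ g₂ →
      ∀ {m : ℝ}, (∀ᶠ τ in atTop, Γ τ ≤ m) →
      ∀ᶠ t in atTop, z t ≤ C * (m ^ (2 / r) + ∫ τ in (t - 1)..t, (g₁ τ + g₂ τ)) := by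
  set D := (16 * c ^ 2) ^ (2 / r) with hD
  have hD0 : 0 ≤ D := by positivity
  refine ⟨80 + 46 * c + 80 * D, by positivity, ?_⟩
  intro y z I Γ g₁ g₂ h m hm
  have hm1 : 1 ≤ m := by
    obtain ⟨τ, hτ, hτ0⟩ := (hm.and (eventually_ge_atTop 0)).exists
    exact (h.one_le τ hτ0).trans hτ
  have hmr : m ≤ m ^ (2 / r) := by
    nth_rewrite 1 [← Real.rpow_one m]
    refine Real.rpow_le_rpow_of_exponent_le hm1 ?_
    rw [le_div_iff₀ (by linarith)]; linarith
  have hshift : Tendsto (fun t : ℝ => t - 1 / 2) atTop atTop :=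
    tendsto_atTop_add_const_right atTop (-(1 / 2)) tendsto_id
  obtain ⟨T, hT⟩ := eventually_atTop.1 hm
  filter_upwards [hshift.eventually (h.eventually_y_le_of_bound hc hr hm),
    eventually_ge_atTop (T + 1), eventually_ge_atTop 1] with t hy htT ht
  have hz := h.z_le hc ht fun τ hτ => hT τ (by have := hτ.1; linarith)
  rw [Real.mul_rpow (by positivity) (by linarith), ← hD] at hy
  have hJ : 0 ≤ ∫ τ in (t - 1)..t, (g₁ τ + g₂ τ) :=
    intervalIntegral.integral_nonneg (by linarith) fun τ hτ =>
      add_nonneg (h.g₁_nonneg τ (by have := hτ.1; linarith))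
        (h.g₂_nonneg τ (by have := hτ.1; linarith))
  have f4 := mul_le_mul_of_nonneg_left hmr (zero_le_one.trans hc)
  generalize (∫ τ in (t - 1)..t, (g₁ τ + g₂ τ)) = J at *
  generalize m ^ (2 / r) = m' at *
  have f7 : 0 ≤ c * J := by positivity
  have f8 : 0 ≤ D * J := by positivity
  nlinarith

/-- For large times, a lower bound `-b` of `Γ'` allows `z` to be estimated by the current value of
`Γ`. -/
theorem eventually_z_bound_of_deriv (hc : 1 ≤ c) (hr : 1 < r) (hr2 : r < 2) :
    ∃ C : ℝ, 0 < C ∧ ∀ {y z I Γ g₁ g₂ : ℝ → ℝ}, EnergyInequalities r c y z I Γ g₁ g₂ →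
      ∀ {b : ℝ}, 1 ≤ b → (∀ᶠ τ in atTop, DifferentiableAt ℝ Γ τ ∧ - deriv Γ τ ≤ b) →
      ∀ᶠ t in atTop,
        z t ≤ C * (b ^ (1 / (r - 1)) + Γ t ^ (2 / r) + ∫ τ in (t - 1)..t, (g₁ τ + g₂ τ)) := by
  set D := (16 * c ^ 2) ^ (2 / r) with hD
  have hD0 : 0 ≤ D := by positivity
  set E := (2 * (16 * c ^ 2) ^ 2) ^ (1 / (r - 1)) with hE
  have hE0 : 0 ≤ E := by positivity
  refine ⟨32 * (46 * c + 80 * D) * (1 + E) + 12, by positivity, ?_⟩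
  intro y z I Γ g₁ g₂ h b hb hΓ
  set β := (2 * (16 * c ^ 2) ^ 2 * b) ^ (r / (2 * (r - 1))) with hβ
  have hβ0 : 0 ≤ β := by positivity
  have hκ : 1 ≤ 16 * c ^ 2 := by nlinarith
  have hB1 : 1 ≤ 2 * (16 * c ^ 2) ^ 2 := by nlinarith
  have hB2 : b ≤ 2 * (16 * c ^ 2) ^ 2 * b := by nlinarith
  have hbβ : b ≤ β := by
    refine hB2.trans ?_
    nth_rewrite 1 [← Real.rpow_one (2 * (16 * c ^ 2) ^ 2 * b)]
    refine Real.rpow_le_rpow_of_exponent_le (hb.trans hB2) ?_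
    rw [le_div_iff₀ (by linarith)]; linarith
  have hβr : β ^ (2 / r) = E * b ^ (1 / (r - 1)) := by
    have hr1 : r - 1 ≠ 0 := by linarith
    rw [hβ, ← Real.rpow_mul (by positivity), hE, ← Real.mul_rpow (by positivity) (by linarith)]
    congr 1
    field_simp
  have hshift : Tendsto (fun t : ℝ => t - 1 / 2) atTop atTop :=
    tendsto_atTop_add_const_right atTop (-(1 / 2)) tendsto_id
  obtain ⟨T, hT⟩ := eventually_atTop.1 hΓ
  filter_upwards [hshift.eventually (h.eventually_y_le_of_deriv hc hr hr2 hb hβ hΓ),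
    eventually_ge_atTop (T + 1), eventually_ge_atTop 1] with t hy htT ht
  -- going back by at most half a time unit, `Γ` grows by at most `b / 2`
  have hback : ∀ τ ∈ Icc (t - 1 / 2) t, Γ τ ≤ Γ t + b := by
    intro τ hτ
    have := le_add_integral_of_deriv_le (f := fun τ => - Γ τ) (φ := fun _ => b) hτ.2
      continuousOn_const fun σ hσ => by
        have h1 := hT σ (by have := hτ.1; have := hσ.1; linarith)
        exact ⟨_, h1.1.hasDerivAt.fun_neg, h1.2⟩
    rw [intervalIntegral.integral_const, smul_eq_mul] at this
    have := hτ.1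
    nlinarith
  have hΓ1 := h.one_le t (by linarith)
  have hz := h.z_le hc ht hback
  have hm1 : 1 ≤ Γ t + b := by linarith
  have hexp1 : 1 ≤ 2 / r := by rw [le_div_iff₀ (by linarith)]; linarith
  have hexp2 : 2 / r ≤ 2 := by rw [div_le_iff₀ (by linarith)]; linarith
  have hS : (Γ t + 2 * β) ^ (2 / r) ≤ 32 * (Γ t ^ (2 / r) + β ^ (2 / r)) := by
    have h1 := add_rpow_le (by linarith : 0 ≤ Γ t) (by linarith : 0 ≤ 2 * β)
      (by linarith : 0 ≤ 2 / r) hexp2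
    have h2 := add_rpow_le hβ0 hβ0 (by linarith : 0 ≤ 2 / r) hexp2
    rw [← two_mul β] at h2
    have h3 : 0 ≤ Γ t ^ (2 / r) := by positivity
    linarith
  have hy' : y (t - 1 / 2) ≤ D * (Γ t + 2 * β) ^ (2 / r) := by
    rw [hD, ← Real.mul_rpow (by positivity) (by positivity)]
    have h0 := h.one_le (t - 1 / 2) (by linarith)
    have h1 := hback (t - 1 / 2) ⟨le_rfl, by linarith⟩
    have h2 : Γ (t - 1 / 2) + β ≤ Γ t + 2 * β := by linarith
    refine hy.trans ?_
    gcongr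
  have hm' : Γ t + b ≤ (Γ t + 2 * β) ^ (2 / r) := by
    calc Γ t + b ≤ Γ t + 2 * β := by linarith
      _ ≤ _ := by
        nth_rewrite 1 [← Real.rpow_one (Γ t + 2 * β)]
        exact Real.rpow_le_rpow_of_exponent_le (by linarith) hexp1
  have hJ : 0 ≤ ∫ τ in (t - 1)..t, (g₁ τ + g₂ τ) :=
    intervalIntegral.integral_nonneg (by linarith) fun τ hτ =>
      add_nonneg (h.g₁_nonneg τ (by have := hτ.1; linarith))
        (h.g₂_nonneg τ (by have := hτ.1; linarith))
  rw [hβr] at hS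
  have hb0 : 0 ≤ b ^ (1 / (r - 1)) := by positivity
  have hG0 : 0 ≤ Γ t ^ (2 / r) := by positivity
  generalize (∫ τ in (t - 1)..t, (g₁ τ + g₂ τ)) = J at *
  generalize b ^ (1 / (r - 1)) = b' at *
  generalize Γ t ^ (2 / r) = G' at *
  generalize (Γ t + 2 * β) ^ (2 / r) = S at *
  have e1 := mul_le_mul_of_nonneg_left hm' (by linarith : 0 ≤ 46 * c)
  have e2 : z t ≤ (46 * c + 80 * D) * S + 12 * J := by linarith
  have hk : 0 ≤ 46 * c + 80 * D := by positivity
  have e3 : S ≤ 32 * ((1 + E) * (b' + G')) := by nlinarith [mul_nonneg hE0 hG0]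
  have e4 := mul_le_mul_of_nonneg_left e3 hk
  have e5 : 0 ≤ 32 * (46 * c + 80 * D) * (1 + E) * J := by positivity
  linarith

end EnergyInequalities

section Hilbert

variable {X V : Type*} [NormedAddCommGroup X] [InnerProductSpace ℝ X]
  [NormedAddCommGroup V] [InnerProductSpace ℝ V]
  {u u' u'' ψ ψ' : ℝ → X} {v v' q q' R : ℝ → V} {I : ℝ → ℝ}

/-- The constant in the energy inequalities, for the exponent `r = 2 - a` and the constant `D` of
the inequality `‖p̄‖^r ≤ D (∫ H + G)`. -/
def energyConst (r D : ℝ) : ℝ := 2 + D + (2 * (4 * D) ^ (1 / r)) ^ (r / (r - 1))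

theorem one_le_energyConst {r D : ℝ} (hD : 0 ≤ D) : 1 ≤ energyConst r D := by
  have : 0 ≤ (2 * (4 * D) ^ (1 / r)) ^ (r / (r - 1)) := by positivity
  unfold energyConst
  linarith

/-- Young's inequality with exponents `r` and `r / (r - 1)` absorbs the term in `Ψ_t`, by means of
the Poincaré inequality. -/
theorem EvolutionCurves.energyInequalities (h : EvolutionCurves u u' u'' ψ ψ' v v' q q' R I)
    {r D : ℝ} {Γ g₁ g₂ : ℝ → ℝ} (hr : 1 < r) (hD : 0 < D)
    (hI0 : ∀ t, 0 ≤ t → 0 ≤ I t) (hg₁0 : ∀ t, 0 ≤ t → 0 ≤ g₁ t) (hg₂0 : ∀ t, 0 ≤ t → 0 ≤ g₂ t)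
    (hΓ : ∀ t, 0 ≤ t → 1 ≤ Γ t) (hu : ContinuousWithinAt u (Ioi 0) 0)
    (hIc : ContinuousOn I (Ici 0)) (hΓc : ContinuousOn Γ (Ici 0)) (hg₁c : ContinuousOn g₁ (Ici 0))
    (hg₂c : ContinuousOn g₂ (Ici 0)) (hq : ∀ t, 0 < t → ‖q t‖ ^ 2 ≤ Γ t)
    (hψ : ∀ t, 0 < t → ‖ψ t‖ ^ 2 ≤ Γ t) (hψr : ∀ t, 0 < t → ‖ψ t‖ ^ (r / (r - 1)) ≤ Γ t)
    (hg₁ : ∀ t, 0 < t → ‖q' t‖ ^ 2 ≤ g₁ t) (hg₂ : ∀ t, 0 < t → ‖ψ' t‖ ^ 2 ≤ g₂ t)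
    (hP : ∀ t, 0 < t → ‖u t‖ ^ r ≤ D * (I t + Γ t)) :
    EnergyInequalities r (energyConst r D) (fun t => ‖u t‖ ^ 2) (fun t => ‖u' t‖ ^ 2)
      I Γ g₁ g₂ where
  y_nonneg t _ := sq_nonneg _
  z_nonneg t _ := sq_nonneg _
  I_nonneg := hI0
  g₁_nonneg := hg₁0
  g₂_nonneg := hg₂0
  one_le := hΓ
  cont_y := by
    intro t ht
    rcases (show 0 ≤ t from ht).eq_or_lt with rfl | ht
    · exact (continuousWithinAt_Ioi_iff_Ici.1 hu).norm.pow 2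
    · exact (h.hasDerivAt_norm_sq ht).continuousAt.continuousWithinAt
  cont_I := hIc
  cont_Γ := hΓc
  cont_g₁ := hg₁c
  cont_g₂ := hg₂c
  deriv_y := by
    intro t ht
    refine ⟨_, h.hasDerivAt_norm_sq ht, ?_, ?_⟩
    · have h1 := h.inner_deriv_le ht
      have h2 := h.le_inner t ht
      have h3 := hq t ht
      have hΓ1 := hΓ t ht.le
      set L := (4 * D) ^ (1 / r) with hL
      have hL0 : 0 < L := by positivity
      have hLr : L ^ r = 4 * D := by
        rw [hL, ← Real.rpow_mul (by positivity), one_div_mul_cancel (by linarith), Real.rpow_one]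
      have hconj : r.HolderConjugate (r / (r - 1)) := by
        have hr1 : r - 1 ≠ 0 := by linarith
        refine Real.holderConjugate_iff.2 ⟨hr, ?_⟩
        field_simp
        ring
      have hy := Real.young_inequality_of_nonneg (a := ‖u t‖ / L) (b := 2 * L * ‖ψ t‖)
        (by positivity) (by positivity) hconj
      have e1 : ‖u t‖ / L * (2 * L * ‖ψ t‖) = 2 * ‖ψ t‖ * ‖u t‖ := by field_simp
      have e2 : (‖u t‖ / L) ^ r / r ≤ (I t + Γ t) / 4 := by
        rw [Real.div_rpow (norm_nonneg _) hL0.le, hLr]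
        have := hP t ht
        calc ‖u t‖ ^ r / (4 * D) / r ≤ ‖u t‖ ^ r / (4 * D) :=
              div_le_self (by positivity) hr.le
          _ ≤ D * (I t + Γ t) / (4 * D) := by gcongr
          _ = (I t + Γ t) / 4 := by field_simp
      have e3 : (2 * L * ‖ψ t‖) ^ (r / (r - 1)) / (r / (r - 1)) ≤
          (2 * L) ^ (r / (r - 1)) * Γ t := by
        rw [Real.mul_rpow (by positivity) (norm_nonneg _)]
        refine (div_le_self (by positivity) hconj.symm.lt.le).trans ?_
        exact mul_le_mul_of_nonneg_left (hψr t ht) (by positivity)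
      have e4 : 0 ≤ D * Γ t := by positivity
      rw [e1] at hy
      unfold energyConst
      rw [← hL]
      linarith
    · have := abs_real_inner_le_norm (u t) (u' t)
      have := pow_le_pow_left₀ (abs_nonneg _) this 2
      rw [sq_abs] at this
      nlinarith
  deriv_I := by
    intro t ht
    refine ⟨_, h.hasDerivAt_energy ht, ?_⟩
    have := h.energy_deriv_le ht
    have := hψ t ht
    have := hg₁ t ht
    linarith
  deriv_z := by
    intro t ht
    refine ⟨_, (h.deriv_u' t ht).norm_sq, ?_⟩
    have := h.norm_sq_deriv_le ht
    have := hg₁ t ht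
    have := hg₂ t ht
    linarith
  poincare := by
    intro t ht
    rw [← Real.rpow_two, ← Real.rpow_mul (norm_nonneg _), mul_div_cancel₀ r two_ne_zero]
    refine (hP t ht).trans ?_
    have h1 := hI0 t ht.le
    have h2 := hΓ t ht.le
    have h3 : 0 ≤ (2 * (4 * D) ^ (1 / r)) ^ (r / (r - 1)) := by positivity
    unfold energyConst
    exact mul_le_mul_of_nonneg_right (by linarith) (by linarith)

end Hilbert

/-! ### Curves in weighted `L²` spaces -/

section L2

variable {n : ℕ} {F : Type*} [NormedAddCommGroup F] {μ : Measure (Space n)}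

open Classical in
/-- The class in `L²(μ)` of a square integrable function; `0` for other functions. -/
def toL2 (μ : Measure (Space n)) (f : Space n → F) : Lp F 2 μ :=
  if h : MemLp f 2 μ then h.toLp f else 0

theorem toL2_eq {f : Space n → F} (hf : MemLp f 2 μ) : toL2 μ f = hf.toLp f := dif_pos hf

theorem coeFn_toL2 {f : Space n → F} (hf : MemLp f 2 μ) : toL2 μ f =ᵐ[μ] f := by
  rw [toL2_eq hf]; exact hf.coeFn_toLp

theorem toL2_sub {f h : Space n → F} (hf : MemLp f 2 μ) (hh : MemLp h 2 μ) :
    toL2 μ (fun x => f x - h x) = toL2 μ f - toL2 μ h := by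
  have hs : MemLp (fun x => f x - h x) 2 μ := hf.sub hh
  rw [toL2_eq hf, toL2_eq hh, toL2_eq hs]; rfl

theorem norm_toL2 {f : Space n → F} (hf : MemLp f 2 μ) :
    ‖toL2 μ f‖ = (eLpNorm f 2 μ).toReal := by
  rw [toL2_eq hf, Lp.norm_toLp]

theorem ofReal_norm_toL2_sq {f : Space n → F} (hf : MemLp f 2 μ) :
    ENNReal.ofReal (‖toL2 μ f‖ ^ 2) = ∫⁻ x, ‖f x‖ₑ ^ 2 ∂μ := by
  have h := eLpNorm_nnreal_pow_eq_lintegral (f := f) (μ := μ) (p := 2) two_ne_zero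
  rw [norm_toL2 hf, ENNReal.ofReal_pow ENNReal.toReal_nonneg, ENNReal.ofReal_toReal hf.2.ne]
  simpa using h

theorem tendsto_toL2 {ι : Type*} {l : Filter ι} {f : ι → Space n → F} {f₀ : Space n → F}
    (h₀ : MemLp f₀ 2 μ) (hf : ∀ᶠ i in l, MemLp (f i) 2 μ)
    (hlim : Tendsto (fun i => eLpNorm (fun x => f i x - f₀ x) 2 μ) l (𝓝 0)) :
    Tendsto (fun i => toL2 μ (f i)) l (𝓝 (toL2 μ f₀)) := by
  rw [tendsto_iff_norm_sub_tendsto_zero]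
  have h1 : Tendsto (fun i => (eLpNorm (fun x => f i x - f₀ x) 2 μ).toReal) l (𝓝 0) := by
    rw [← ENNReal.toReal_zero]
    exact (ENNReal.tendsto_toReal ENNReal.zero_ne_top).comp hlim
  refine h1.congr' ?_
  filter_upwards [hf] with i hi
  have hs : MemLp (fun x => f i x - f₀ x) 2 μ := hi.sub h₀
  rw [← toL2_sub hi h₀, norm_toL2 hs]

theorem memLp_of_tendsto {ι : Type*} {l : Filter ι} {f : ι → Space n → F} {f₀ : Space n → F}
    (h₀ : MemLp f₀ 2 μ) (hf : ∀ i, AEStronglyMeasurable (f i) μ)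
    (hlim : Tendsto (fun i => eLpNorm (fun x => f i x - f₀ x) 2 μ) l (𝓝 0)) :
    ∀ᶠ i in l, MemLp (f i) 2 μ := by
  filter_upwards [hlim.eventually (gt_mem_nhds ENNReal.zero_lt_top)] with i hi
  have h1 : MemLp (fun x => f i x - f₀ x) 2 μ := ⟨(hf i).sub h₀.1, hi⟩
  have h2 := h1.add h₀
  have e : ((fun x => f i x - f₀ x) + f₀) = f i := by ext x; simp
  rwa [e] at h2

theorem HasL2DerivAt.sub [NormedSpace ℝ F] {f h : ℝ → Space n → F} {f' h' : Space n → F} {t : ℝ}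
    (ht : 0 < t) (hf : HasL2DerivAt μ f f' t) (hh : HasL2DerivAt μ h h' t)
    (hfm : ∀ s, 0 < s → AEStronglyMeasurable (f s) μ)
    (hhm : ∀ s, 0 < s → AEStronglyMeasurable (h s) μ) :
    HasL2DerivAt μ (fun s x => f s x - h s x) (fun x => f' x - h' x) t := by
  refine ⟨hf.1.sub hh.1, ?_⟩
  have h0 := hf.2.add hh.2
  rw [add_zero] at h0
  refine tendsto_of_tendsto_of_tendsto_of_le_of_le' tendsto_const_nhds h0
    (Eventually.of_forall fun _ => zero_le) ?_
  have hpos : ∀ᶠ ε in 𝓝[≠] (0 : ℝ), 0 < t + ε := by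
    have : Tendsto (fun ε : ℝ => t + ε) (𝓝[≠] 0) (𝓝 t) := by
      simpa using (tendsto_id.const_add t).mono_left (nhdsWithin_le_nhds (a := (0 : ℝ)))
    exact this.eventually (lt_mem_nhds ht)
  filter_upwards [hpos] with ε hε
  have e : (fun x => ε⁻¹ • (f (t + ε) x - h (t + ε) x - (f t x - h t x)) - (f' x - h' x)) =
      (fun x => ε⁻¹ • (f (t + ε) x - f t x) - f' x) -
        (fun x => ε⁻¹ • (h (t + ε) x - h t x) - h' x) := by
    ext x
    simp only [Pi.sub_apply, smul_sub]
    abel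
  rw [e]
  exact eLpNorm_sub_le ((((hfm _ hε).sub (hfm t ht)).const_smul _).sub hf.1.1)
    ((((hhm _ hε).sub (hhm t ht)).const_smul _).sub hh.1.1) (by norm_num)

theorem HasL2DerivAt.hasDerivAt [NormedSpace ℝ F] {f : ℝ → Space n → F} {f' : Space n → F} {t : ℝ}
    (ht : 0 < t) (hf : HasL2DerivAt μ f f' t) (hfm : ∀ s, 0 < s → MemLp (f s) 2 μ) :
    HasDerivAt (fun s => toL2 μ (f s)) (toL2 μ f') t := by
  rw [hasDerivAt_iff_tendsto_slope_zero]
  have hpos : ∀ᶠ ε in 𝓝[≠] (0 : ℝ), 0 < t + ε := by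
    have : Tendsto (fun ε : ℝ => t + ε) (𝓝[≠] 0) (𝓝 t) := by
      simpa using (tendsto_id.const_add t).mono_left (nhdsWithin_le_nhds (a := (0 : ℝ)))
    exact this.eventually (lt_mem_nhds ht)
  have hmem : ∀ᶠ ε in 𝓝[≠] (0 : ℝ), MemLp (fun x => ε⁻¹ • (f (t + ε) x - f t x)) 2 μ := by
    filter_upwards [hpos] with ε hε
    exact ((hfm _ hε).sub (hfm t ht)).const_smul ε⁻¹
  refine (tendsto_toL2 hf.1 hmem hf.2).congr' ?_
  filter_upwards [hpos, hmem] with ε hε hm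
  have hs : MemLp (fun x => f (t + ε) x - f t x) 2 μ := (hfm _ hε).sub (hfm t ht)
  rw [← toL2_sub (hfm _ hε) (hfm t ht), toL2_eq hm, toL2_eq hs]
  rfl

theorem inner_toL2 [InnerProductSpace ℝ F] {f h : Space n → F} (hf : MemLp f 2 μ)
    (hh : MemLp h 2 μ) : inner ℝ (toL2 μ f) (toL2 μ h) = ∫ x, inner ℝ (f x) (h x) ∂μ := by
  rw [L2.inner_def]
  refine integral_congr_ae ?_
  filter_upwards [coeFn_toL2 hf, coeFn_toL2 hh] with x h1 h2
  rw [h1, h2]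

theorem integrable_inner_of_memLp [InnerProductSpace ℝ F] {f h : Space n → F} (hf : MemLp f 2 μ)
    (hh : MemLp h 2 μ) : Integrable (fun x => inner ℝ (f x) (h x)) μ := by
  refine (L2.integrable_inner (𝕜 := ℝ) (toL2 μ f) (toL2 μ h)).congr ?_
  filter_upwards [coeFn_toL2 hf, coeFn_toL2 hh] with x h1 h2
  rw [h1, h2]

theorem norm_toL2_sq_le_inner [InnerProductSpace ℝ F] {f h k : Space n → F} (hf : MemLp f 2 μ)
    (hh : MemLp h 2 μ) (hk : MemLp k 2 μ) (hle : ∀ᵐ x ∂μ, ‖f x‖ ^ 2 ≤ inner ℝ (h x) (k x)) :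
    ‖toL2 μ f‖ ^ 2 ≤ inner ℝ (toL2 μ h) (toL2 μ k) := by
  rw [← real_inner_self_eq_norm_sq, inner_toL2 hf hf, inner_toL2 hh hk]
  refine integral_mono_ae (integrable_inner_of_memLp hf hf) (integrable_inner_of_memLp hh hk) ?_
  filter_upwards [hle] with x hx
  rwa [real_inner_self_eq_norm_sq]

/-- Comparison of two lower integrals that differ by an integrable function. The functions `f₁` and
`f₂` need not be measurable. -/
theorem toReal_lintegral_add_integral_le {f₁ f₂ d : Space n → ℝ} (hd : Integrable d μ)
    (h₁ : ∫⁻ x, ENNReal.ofReal (f₁ x) ∂μ ≠ ⊤) (h₂ : ∫⁻ x, ENNReal.ofReal (f₂ x) ∂μ ≠ ⊤)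
    (hf₁ : ∀ᵐ x ∂μ, 0 ≤ f₁ x) (hf₂ : ∀ᵐ x ∂μ, 0 ≤ f₂ x) (hle : ∀ᵐ x ∂μ, f₁ x + d x ≤ f₂ x) :
    (∫⁻ x, ENNReal.ofReal (f₁ x) ∂μ).toReal + ∫ x, d x ∂μ ≤
      (∫⁻ x, ENNReal.ofReal (f₂ x) ∂μ).toReal := by
  have hp : ∫⁻ x, ENNReal.ofReal (d x) ∂μ ≠ ⊤ := hd.lintegral_lt_top.ne
  have hn : ∫⁻ x, ENNReal.ofReal (- d x) ∂μ ≠ ⊤ := hd.neg.lintegral_lt_top.ne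
  have key : (∫⁻ x, ENNReal.ofReal (f₁ x) ∂μ) + ∫⁻ x, ENNReal.ofReal (d x) ∂μ ≤
      (∫⁻ x, ENNReal.ofReal (f₂ x) ∂μ) + ∫⁻ x, ENNReal.ofReal (- d x) ∂μ := by
    rw [← lintegral_add_right' _ hd.aemeasurable.ennreal_ofReal,
      ← lintegral_add_right' _ hd.aemeasurable.fun_neg.ennreal_ofReal]
    refine lintegral_mono_ae ?_
    filter_upwards [hf₁, hf₂, hle] with x h1 h2 h3
    rcases le_total 0 (d x) with h | h
    · rw [← ENNReal.ofReal_add h1 h]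
      exact (ENNReal.ofReal_le_ofReal h3).trans le_self_add
    · rw [ENNReal.ofReal_of_nonpos h, add_zero, ← ENNReal.ofReal_add h2 (by linarith)]
      exact ENNReal.ofReal_le_ofReal (by linarith)
  rw [integral_eq_lintegral_pos_part_sub_lintegral_neg_part hd]
  have := ENNReal.toReal_mono (ENNReal.add_ne_top.2 ⟨h₂, hn⟩) key
  rw [ENNReal.toReal_add h₁ hp, ENNReal.toReal_add h₂ hn] at this
  linarith

variable {U : Set (Space n)} {w : Space n → ℝ}

theorem lintegral_wMeasure (hw : AEMeasurable w (volume.restrict U))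
    (f : Space n → ℝ≥0∞) :
    ∫⁻ x, f x ∂(wMeasure U w) = ∫⁻ x in U, ENNReal.ofReal (w x) * f x :=
  lintegral_withDensity_eq_lintegral_mul_non_measurable₀ _ hw.ennreal_ofReal
    (Eventually.of_forall fun _ => ENNReal.ofReal_lt_top) f

theorem integral_wMeasure (hU : MeasurableSet U) (hw : AEMeasurable w (volume.restrict U))
    (hw0 : ∀ x ∈ U, 0 ≤ w x) (f : Space n → ℝ) :
    ∫ x, f x ∂(wMeasure U w) = ∫ x in U, w x * f x := by
  rw [wMeasure, integral_withDensity_eq_integral_toReal_smul₀ hw.ennreal_ofReal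
    (Eventually.of_forall fun _ => ENNReal.ofReal_lt_top)]
  refine setIntegral_congr_fun hU fun x hx => ?_
  simp only [smul_eq_mul, ENNReal.toReal_ofReal (hw0 x hx)]

theorem integrable_wMeasure (hU : MeasurableSet U) (hw : AEMeasurable w (volume.restrict U))
    (hw0 : ∀ x ∈ U, 0 ≤ w x) {f : Space n → ℝ} (hf : Integrable f (wMeasure U w)) :
    Integrable (fun x => w x * f x) (volume.restrict U) := by
  rw [wMeasure, integrable_withDensity_iff_integrable_smul₀' hw.ennreal_ofReal
    (Eventually.of_forall fun _ => ENNReal.ofReal_lt_top)] at hf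
  refine hf.congr ((ae_restrict_iff' hU).2 (Eventually.of_forall fun x hx => ?_))
  simp only [smul_eq_mul, ENNReal.toReal_ofReal (hw0 x hx)]

theorem posInt_eq_lintegral_wMeasure (hU : MeasurableSet U)
    (hw : AEMeasurable w (volume.restrict U)) (hw0 : ∀ x ∈ U, 0 ≤ w x) {f : Space n → F}
    {k : Space n → ℝ} (hk : ∀ x ∈ U, k x = w x * ‖f x‖ ^ 2) :
    posInt U k = ∫⁻ x, ‖f x‖ₑ ^ 2 ∂(wMeasure U w) := by
  rw [lintegral_wMeasure hw]
  refine setLIntegral_congr_fun hU fun x hx => ?_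
  simp only [hk x hx]
  rw [ENNReal.ofReal_mul (hw0 x hx), ENNReal.ofReal_pow (norm_nonneg _), ofReal_norm]

theorem posInt_eq_ofReal_norm_sq (hU : MeasurableSet U) (hw : AEMeasurable w (volume.restrict U))
    (hw0 : ∀ x ∈ U, 0 ≤ w x) {f : Space n → F} (hf : MemLp f 2 (wMeasure U w))
    {k : Space n → ℝ} (hk : ∀ x ∈ U, k x = w x * ‖f x‖ ^ 2) :
    posInt U k = ENNReal.ofReal (‖toL2 (wMeasure U w) f‖ ^ 2) := by
  rw [ofReal_norm_toL2_sq hf, posInt_eq_lintegral_wMeasure hU hw hw0 hk]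

theorem memLp_of_posInt_ne_top (hU : MeasurableSet U) (hw : AEMeasurable w (volume.restrict U))
    (hw0 : ∀ x ∈ U, 0 ≤ w x) {f : Space n → F} (hf : AEStronglyMeasurable f (wMeasure U w))
    {k : Space n → ℝ} (hk : ∀ x ∈ U, k x = w x * ‖f x‖ ^ 2) (hfin : posInt U k ≠ ⊤) :
    MemLp f 2 (wMeasure U w) := by
  refine ⟨hf, ?_⟩
  rw [posInt_eq_lintegral_wMeasure hU hw hw0 hk] at hfin
  have h := eLpNorm_nnreal_pow_eq_lintegral (f := f) (μ := wMeasure U w) (p := 2) two_ne_zero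
  by_contra hcon
  rw [not_lt, top_le_iff] at hcon
  refine hfin ?_
  have h2 : eLpNorm f ((2 : ℝ≥0) : ℝ≥0∞) (wMeasure U w) = ⊤ := by simpa using hcon
  rw [h2] at h
  simpa using h.symm

theorem aestronglyMeasurable_wMeasure {f : Space n → F}
    (hf : AEStronglyMeasurable f (volume.restrict U)) : AEStronglyMeasurable f (wMeasure U w) :=
  hf.mono_ac (withDensity_absolutelyContinuous _ _)

theorem ae_wMeasure_of_forall (hU : MeasurableSet U) {P : Space n → Prop} (hP : ∀ x ∈ U, P x) :
    ∀ᵐ x ∂(wMeasure U w), P x :=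
  (withDensity_absolutelyContinuous _ _).ae_le
    ((ae_restrict_iff' hU).2 (Eventually.of_forall hP))

end L2

/-! ### The solution as a pair of curves -/

section Flow

variable {n N : ℕ} {U : Set (Space n)} {α : Fin (N + 1) → ℝ} {a : Fin (N + 1) → Space n → ℝ}
  {φ : Space n → ℝ} {cP : ℝ} {p Ψ : RegularFun U φ (fun x => (a 0 x)⁻¹)}

/-- A solution `p` with boundary data `Ψ`, together with the standing assumptions on the domain, the
coefficients and the finiteness of the data. -/
structure IsFlow (U : Set (Space n)) (α : Fin (N + 1) → ℝ) (a : Fin (N + 1) → Space n → ℝ)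
    (φ : Space n → ℝ) (cP : ℝ) (p Ψ : RegularFun U φ (fun x => (a 0 x)⁻¹)) : Prop where
  isOpen : IsOpen U
  exponents : IsExponents α
  coefficients : IsCoefficients U a
  porosity : IsPorosity U φ
  solution : IsSolution U α a φ p Ψ
  poincare : PoincareSobolev α a cP p Ψ
  finite_G : FiniteContinuous (G α a Ψ)
  finite_G1 : FiniteContinuous (G1 a Ψ)
  finite_G2 : FiniteContinuous (G2 Ψ)
  finite_H : FiniteContinuous (intH α a p)

theorem one_le_G {Ψ : RegularFun U φ (fun x => (a 0 x)⁻¹)} (t : ℝ) : 1 ≤ G α a Ψ t := by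
  unfold G Bstar
  rw [add_assoc, add_assoc]
  exact le_add_right (le_max_right _ _)

theorem RegularFun.aestronglyMeasurable_val {b : Space n → ℝ} (u : RegularFun U φ b) {t : ℝ}
    (ht : 0 ≤ t) : AEStronglyMeasurable (u.val t) (wMeasure U φ) :=
  aestronglyMeasurable_wMeasure (u.isWeakGradient t ht).locInt.aestronglyMeasurable

theorem RegularFun.tendsto_sub_zero {b : Space n → ℝ} (p Ψ : RegularFun U φ b) :
    Tendsto (fun t => eLpNorm (fun x => (p.val t x - Ψ.val t x) - (p.val 0 x - Ψ.val 0 x)) 2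
      (wMeasure U φ)) (𝓝[>] 0) (𝓝 0) := by
  have h0 := p.continuous_zero.add Ψ.continuous_zero
  rw [add_zero] at h0
  refine tendsto_of_tendsto_of_tendsto_of_le_of_le' tendsto_const_nhds h0
    (Eventually.of_forall fun _ => zero_le) ?_
  filter_upwards [self_mem_nhdsWithin] with t ht
  have ht0 : 0 ≤ t := le_of_lt ht
  have e : (fun x => (p.val t x - Ψ.val t x) - (p.val 0 x - Ψ.val 0 x)) =
      (fun x => p.val t x - p.val 0 x) - (fun x => Ψ.val t x - Ψ.val 0 x) := by
    ext x
    simp only [Pi.sub_apply]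
    ring
  rw [e]
  exact eLpNorm_sub_le
    ((p.aestronglyMeasurable_val ht0).sub (p.aestronglyMeasurable_val le_rfl))
    ((Ψ.aestronglyMeasurable_val ht0).sub (Ψ.aestronglyMeasurable_val le_rfl)) (by norm_num)

namespace IsFlow

theorem measurableSet (h : IsFlow U α a φ cP p Ψ) : MeasurableSet U := h.isOpen.measurableSet

theorem weight_aemeasurable (h : IsFlow U α a φ cP p Ψ) :
    AEMeasurable (fun x => (a 0 x)⁻¹) (volume.restrict U) := (h.coefficients.aemeasurable 0).inv

theorem weight_nonneg (h : IsFlow U α a φ cP p Ψ) : ∀ x ∈ U, 0 ≤ (a 0 x)⁻¹ :=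
  fun x hx => (inv_pos.2 (h.coefficients.first_pos x hx)).le

theorem porosity_nonneg (h : IsFlow U α a φ cP p Ψ) : ∀ x ∈ U, 0 ≤ φ x :=
  fun x hx => (h.porosity.pos x hx).le

theorem memLp_grad_Ψ (h : IsFlow U α a φ cP p Ψ) {t : ℝ} (ht : 0 ≤ t) :
    MemLp (Ψ.grad t) 2 (wMeasure U (fun x => (a 0 x)⁻¹)) := by
  refine memLp_of_posInt_ne_top h.measurableSet h.weight_aemeasurable h.weight_nonneg
    (aestronglyMeasurable_wMeasure (Ψ.isWeakGradient t ht).locIntGrad.aestronglyMeasurable)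
    (fun _ _ => rfl) (ne_top_of_le_ne_top (h.finite_G.1 t ht) ?_)
  unfold G
  exact (le_add_self.trans le_self_add).trans le_self_add

theorem memLp_grad_p (h : IsFlow U α a φ cP p Ψ) {t : ℝ} (ht : 0 < t) :
    MemLp (p.grad t) 2 (wMeasure U (fun x => (a 0 x)⁻¹)) := by
  have := (h.solution.boundary t ht).2.1.add (h.memLp_grad_Ψ ht.le)
  have e : (fun x => p.grad t x - Ψ.grad t x) + Ψ.grad t = p.grad t := by ext1 x; simp
  rwa [e] at this

theorem memLp_val (h : IsFlow U α a φ cP p Ψ) {t : ℝ} (ht : 0 < t) :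
    MemLp (fun x => p.val t x - Ψ.val t x) 2 (wMeasure U φ) := (h.solution.boundary t ht).1

/-- Continuity at `t = 0` in `L²(φ dx)` makes the initial value square integrable. -/
theorem memLp_val_zero (h : IsFlow U α a φ cP p Ψ) :
    MemLp (fun x => p.val 0 x - Ψ.val 0 x) 2 (wMeasure U φ) := by
  obtain ⟨t, htop, ht⟩ := (((p.tendsto_sub_zero Ψ).eventually
    (gt_mem_nhds ENNReal.zero_lt_top)).and self_mem_nhdsWithin).exists
  have ht0 : (0 : ℝ) < t := ht
  have hm : MemLp (fun x => (p.val t x - Ψ.val t x) - (p.val 0 x - Ψ.val 0 x)) 2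
      (wMeasure U φ) :=
    ⟨(h.memLp_val ht0).1.sub ((p.aestronglyMeasurable_val le_rfl).sub
      (Ψ.aestronglyMeasurable_val le_rfl)), htop⟩
  have := (h.memLp_val ht0).sub hm
  have e : ((fun x => p.val t x - Ψ.val t x) -
      fun x => (p.val t x - Ψ.val t x) - (p.val 0 x - Ψ.val 0 x)) =
      fun x => p.val 0 x - Ψ.val 0 x := by ext x; simp
  rwa [e] at this

theorem aestronglyMeasurable_flux (h : IsFlow U α a φ cP p Ψ) {t : ℝ} (ht : 0 < t) :
    AEStronglyMeasurable (fun x => flux α a x (p.grad t x)) (volume.restrict U) :=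
  (h.solution.flux_locInt t ht).aestronglyMeasurable

/-- The rescaled flux `a₀ K(x, |∇p|) ∇p` belongs to `L²(a₀⁻¹ dx)`. -/
theorem memLp_flux (h : IsFlow U α a φ cP p Ψ) {t : ℝ} (ht : 0 < t) :
    MemLp (fun x => a 0 x • flux α a x (p.grad t x)) 2 (wMeasure U (fun x => (a 0 x)⁻¹)) := by
  refine (h.memLp_grad_p ht).of_le (aestronglyMeasurable_wMeasure
    ((h.coefficients.aemeasurable 0).aestronglyMeasurable.smul (h.aestronglyMeasurable_flux ht)))
    (ae_wMeasure_of_forall h.measurableSet fun x hx => ?_)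
  have ha := h.coefficients.coeffAt hx
  rw [norm_smul, Real.norm_of_nonneg ha.pos.le]
  exact first_mul_norm_flux_le h.exponents ha _

theorem integrable_inner_flux (h : IsFlow U α a φ cP p Ψ) {t : ℝ} (ht : 0 < t)
    {v : Space n → Space n} (hv : MemLp v 2 (wMeasure U (fun x => (a 0 x)⁻¹))) :
    Integrable (fun x => inner ℝ (flux α a x (p.grad t x)) (v x)) (volume.restrict U) := by
  refine (integrable_wMeasure h.measurableSet h.weight_aemeasurable h.weight_nonneg
    (integrable_inner_of_memLp (h.memLp_flux ht) hv)).congr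
    ((ae_restrict_iff' h.measurableSet).2 (Eventually.of_forall fun x hx => ?_))
  have := (h.coefficients.first_pos x hx).ne'
  simp only [real_inner_smul_left]
  field_simp

theorem inner_flux (h : IsFlow U α a φ cP p Ψ) {t : ℝ} (ht : 0 < t)
    {v : Space n → Space n} (hv : MemLp v 2 (wMeasure U (fun x => (a 0 x)⁻¹))) :
    inner ℝ (toL2 (wMeasure U (fun x => (a 0 x)⁻¹)) (fun x => a 0 x • flux α a x (p.grad t x)))
      (toL2 (wMeasure U (fun x => (a 0 x)⁻¹)) v) =
      ∫ x in U, inner ℝ (flux α a x (p.grad t x)) (v x) := by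
  rw [inner_toL2 (h.memLp_flux ht) hv,
    integral_wMeasure h.measurableSet h.weight_aemeasurable h.weight_nonneg]
  refine setIntegral_congr_fun h.measurableSet fun x hx => ?_
  have := (h.coefficients.first_pos x hx).ne'
  simp only [real_inner_smul_left]
  field_simp

/-- The weak formulation extends, by density, from test functions to functions that vanish on the
boundary. -/
theorem weak_formulation (h : IsFlow U α a φ cP p Ψ) {t : ℝ} (ht : 0 < t) {u : Space n → ℝ}
    {v : Space n → Space n} (hu : VanishesOnBoundary U φ (fun x => (a 0 x)⁻¹) u v) :
    inner ℝ (toL2 (wMeasure U φ) (p.dt t)) (toL2 (wMeasure U φ) u) =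
      - inner ℝ (toL2 (wMeasure U (fun x => (a 0 x)⁻¹))
          (fun x => a 0 x • flux α a x (p.grad t x)))
        (toL2 (wMeasure U (fun x => (a 0 x)⁻¹)) v) := by
  obtain ⟨hum, hvm, w, hw, hwu, hwv⟩ := hu
  have hcont : ∀ k, Continuous (gradient (w k)) := fun k =>
    (InnerProductSpace.toDual ℝ (Space n)).symm.continuous.comp
      ((hw k).contDiff.continuous_fderiv one_ne_zero)
  have hw1 := memLp_of_tendsto hum (fun k => (hw k).contDiff.continuous.aestronglyMeasurable) hwu
  have hw2 := memLp_of_tendsto hvm (fun k => (hcont k).aestronglyMeasurable) hwv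
  have hl1 := (tendsto_const_nhds (x := toL2 (wMeasure U φ) (p.dt t))).inner (𝕜 := ℝ)
    (tendsto_toL2 hum hw1 hwu)
  have hl2 := ((tendsto_const_nhds (x := toL2 (wMeasure U (fun x => (a 0 x)⁻¹))
    (fun x => a 0 x • flux α a x (p.grad t x)))).inner (𝕜 := ℝ) (tendsto_toL2 hvm hw2 hwv)).neg
  refine tendsto_nhds_unique (hl1.congr' ?_) hl2
  filter_upwards [hw1, hw2] with k h1 h2
  rw [inner_toL2 (p.hasDeriv_val t ht).1 h1, h.inner_flux ht h2,
    integral_wMeasure h.measurableSet h.porosity.aemeasurable h.porosity_nonneg]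
  refine Eq.trans ?_ (h.solution.equation t ht (w k) (hw k))
  refine integral_congr_ae (Eventually.of_forall fun x => ?_)
  simp only [RCLike.inner_apply, conj_trivial]
  ring

/-- The curves of the abstract evolution problem attached to a solution. -/
theorem evolutionCurves (h : IsFlow U α a φ cP p Ψ) :
    EvolutionCurves
      (fun t => toL2 (wMeasure U φ) (fun x => p.val t x - Ψ.val t x))
      (fun t => toL2 (wMeasure U φ) (fun x => p.dt t x - Ψ.dt t x))
      (fun t => toL2 (wMeasure U φ) (fun x => p.dtt t x - Ψ.dtt t x))
      (fun t => toL2 (wMeasure U φ) (Ψ.dt t))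
      (fun t => toL2 (wMeasure U φ) (Ψ.dtt t))
      (fun t => toL2 (wMeasure U (fun x => (a 0 x)⁻¹)) (p.grad t))
      (fun t => toL2 (wMeasure U (fun x => (a 0 x)⁻¹)) (p.gradDt t))
      (fun t => toL2 (wMeasure U (fun x => (a 0 x)⁻¹)) (Ψ.grad t))
      (fun t => toL2 (wMeasure U (fun x => (a 0 x)⁻¹)) (Ψ.gradDt t))
      (fun t => toL2 (wMeasure U (fun x => (a 0 x)⁻¹))
        (fun x => a 0 x • flux α a x (p.grad t x)))
      (fun t => (intH α a p t).toReal) where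
  deriv_u t ht := ((p.hasDeriv_val t ht).sub ht (Ψ.hasDeriv_val t ht)
    (fun _ hs => p.aestronglyMeasurable_val hs.le)
    (fun _ hs => Ψ.aestronglyMeasurable_val hs.le)).hasDerivAt ht fun _ hs => h.memLp_val hs
  deriv_u' t ht := ((p.hasDeriv_dt t ht).sub ht (Ψ.hasDeriv_dt t ht)
    (fun s hs => (p.hasDeriv_val s hs).1.1)
    (fun s hs => (Ψ.hasDeriv_val s hs).1.1)).hasDerivAt ht
      fun s hs => (p.hasDeriv_val s hs).1.sub (Ψ.hasDeriv_val s hs).1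
  deriv_ψ t ht := (Ψ.hasDeriv_dt t ht).hasDerivAt ht fun s hs => (Ψ.hasDeriv_val s hs).1
  deriv_v t ht := (p.hasDeriv_grad t ht).hasDerivAt ht fun _ hs => h.memLp_grad_p hs
  deriv_q t ht := (Ψ.hasDeriv_grad t ht).hasDerivAt ht fun _ hs => h.memLp_grad_Ψ hs.le
  weak t ht s hs := by
    rw [toL2_sub (p.hasDeriv_val t ht).1 (Ψ.hasDeriv_val t ht).1, sub_add_cancel,
      ← toL2_sub (h.memLp_grad_p hs) (h.memLp_grad_Ψ hs.le)]
    exact h.weak_formulation ht (h.solution.boundary s hs)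
  cocoercive t ht s hs := by
    rw [← toL2_sub (h.memLp_flux hs) (h.memLp_flux ht),
      ← toL2_sub (h.memLp_grad_p hs) (h.memLp_grad_p ht)]
    refine norm_toL2_sq_le_inner ((h.memLp_flux hs).sub (h.memLp_flux ht))
      ((h.memLp_flux hs).sub (h.memLp_flux ht)) ((h.memLp_grad_p hs).sub (h.memLp_grad_p ht))
      (ae_wMeasure_of_forall h.measurableSet fun x hx => ?_)
    have ha := h.coefficients.coeffAt hx
    have := mul_le_mul_of_nonneg_left
      (flux_cocoercive h.exponents ha (p.grad s x) (p.grad t x)) ha.pos.le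
    rw [← smul_sub, norm_smul, real_inner_smul_left, Real.norm_of_nonneg ha.pos.le]
    linarith
  convex t ht s hs := by
    have hd : MemLp (fun x => p.grad s x - p.grad t x) 2 (wMeasure U (fun x => (a 0 x)⁻¹)) :=
      (h.memLp_grad_p hs).sub (h.memLp_grad_p ht)
    rw [← toL2_sub (h.memLp_grad_p hs) (h.memLp_grad_p ht), h.inner_flux ht hd]
    have hae : ∀ {P : Space n → Prop}, (∀ x ∈ U, P x) → ∀ᵐ x ∂(volume.restrict U), P x :=
      fun hP => (ae_restrict_iff' h.measurableSet).2 (Eventually.of_forall hP)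
    have := toReal_lintegral_add_integral_le ((h.integrable_inner_flux ht hd).const_mul 2)
      (h.finite_H.1 t ht.le) (h.finite_H.1 s hs.le)
      (hae fun x hx => H_nonneg h.exponents (h.coefficients.coeffAt hx) (norm_nonneg _))
      (hae fun x hx => H_nonneg h.exponents (h.coefficients.coeffAt hx) (norm_nonneg _))
      (hae fun x hx => by
        have := inner_flux_le_H_sub h.exponents (h.coefficients.coeffAt hx) (p.grad t x)
          (p.grad s x)
        linarith)
    rw [integral_const_mul] at this
    exact le_sub_iff_add_le'.2 this
  norm_sq_le t ht := by
    refine norm_toL2_sq_le_inner (h.memLp_flux ht) (h.memLp_flux ht) (h.memLp_grad_p ht)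
      (ae_wMeasure_of_forall h.measurableSet fun x hx => ?_)
    have ha := h.coefficients.coeffAt hx
    have h1 := first_mul_norm_flux_le h.exponents ha (p.grad t x)
    rw [real_inner_smul_left, inner_flux_self h.exponents ha, ← norm_flux h.exponents ha, norm_smul,
      Real.norm_of_nonneg ha.pos.le]
    have h2 := norm_nonneg (flux α a x (p.grad t x))
    have := mul_le_mul_of_nonneg_left h1 (mul_nonneg ha.pos.le h2)
    linarith
  inner_le t ht := by
    have hg := h.memLp_grad_p ht
    rw [h.inner_flux ht hg]
    have hae : ∀ {P : Space n → Prop}, (∀ x ∈ U, P x) → ∀ᵐ x ∂(volume.restrict U), P x :=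
      fun hP => (ae_restrict_iff' h.measurableSet).2 (Eventually.of_forall hP)
    have := toReal_lintegral_add_integral_le (f₁ := fun _ => 0) (h.integrable_inner_flux ht hg)
      (by simp) (h.finite_H.1 t ht.le) (hae fun _ _ => le_rfl)
      (hae fun x hx => H_nonneg h.exponents (h.coefficients.coeffAt hx) (norm_nonneg _))
      (hae fun x hx => by
        rw [inner_flux_self h.exponents (h.coefficients.coeffAt hx), zero_add]
        exact root_mul_le_H h.exponents (h.coefficients.coeffAt hx) (norm_nonneg _))
    simp only [ENNReal.ofReal_zero, lintegral_zero, ENNReal.toReal_zero, zero_add] at this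
    exact this
  le_inner t ht := by
    have hg := h.memLp_grad_p ht
    rw [h.inner_flux ht hg]
    have hae : ∀ {P : Space n → Prop}, (∀ x ∈ U, P x) → ∀ᵐ x ∂(volume.restrict U), P x :=
      fun hP => (ae_restrict_iff' h.measurableSet).2 (Eventually.of_forall hP)
    have := toReal_lintegral_add_integral_le (f₂ := fun _ => 0)
      ((h.integrable_inner_flux ht hg).const_mul (-2)) (h.finite_H.1 t ht.le) (by simp)
      (hae fun x hx => H_nonneg h.exponents (h.coefficients.coeffAt hx) (norm_nonneg _))
      (hae fun _ _ => le_rfl)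
      (hae fun x hx => by
        have := H_le_root_mul h.exponents (h.coefficients.coeffAt hx) (norm_nonneg (p.grad t x))
        rw [inner_flux_self h.exponents (h.coefficients.coeffAt hx)]
        linarith)
    rw [integral_const_mul] at this
    simp only [ENNReal.ofReal_zero, lintegral_zero, ENNReal.toReal_zero] at this
    change (intH α a p t).toReal + _ ≤ 0 at this
    linarith

end IsFlow

/-! ### The energy inequalities for a solution -/

theorem FiniteContinuous.continuousOn_toReal {f : ℝ → ℝ≥0∞} (hf : FiniteContinuous f) :
    ContinuousOn (fun t => (f t).toReal) (Ici 0) :=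
  ENNReal.continuousOn_toReal.comp hf.2 fun t ht => hf.1 t ht

namespace IsFlow

theorem normSq_eq (h : IsFlow U α a φ cP p Ψ) {t : ℝ} (ht : 0 ≤ t) :
    normSq p Ψ t =
      ENNReal.ofReal (‖toL2 (wMeasure U φ) (fun x => p.val t x - Ψ.val t x)‖ ^ 2) := by
  have hm : MemLp (fun x => p.val t x - Ψ.val t x) 2 (wMeasure U φ) := by
    rcases ht.eq_or_lt with rfl | ht
    · exact h.memLp_val_zero
    · exact h.memLp_val ht
  exact posInt_eq_ofReal_norm_sq h.measurableSet h.porosity.aemeasurable h.porosity_nonneg hm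
    fun x _ => by rw [Real.norm_eq_abs, sq_abs, mul_comm]

theorem normSqDt_eq (h : IsFlow U α a φ cP p Ψ) {t : ℝ} (ht : 0 < t) :
    normSqDt p Ψ t =
      ENNReal.ofReal (‖toL2 (wMeasure U φ) (fun x => p.dt t x - Ψ.dt t x)‖ ^ 2) :=
  posInt_eq_ofReal_norm_sq h.measurableSet h.porosity.aemeasurable h.porosity_nonneg
    (f := fun x => p.dt t x - Ψ.dt t x) ((p.hasDeriv_val t ht).1.sub (Ψ.hasDeriv_val t ht).1)
    fun x _ => by rw [Real.norm_eq_abs, sq_abs, mul_comm]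

/-- `∫ W₁ |∇p̄|^{2-a}` is controlled by the energy and by `G`. -/
theorem posInt_W1_le (h : IsFlow U α a φ cP p Ψ) {t : ℝ} (ht : 0 < t) :
    posInt U (fun x => W1 α a x * ‖p.grad t x - Ψ.grad t x‖ ^ (2 - expo α)) ≤
      4 * (intH α a p t + G α a Ψ t) := by
  have he0 := expo_pos h.exponents
  have he1 := expo_lt_one h.exponents
  set r := 2 - expo α with hr
  have hpt : ∀ x ∈ U, ENNReal.ofReal (W1 α a x * ‖p.grad t x - Ψ.grad t x‖ ^ r) ≤
      4 * ((ENNReal.ofReal (inner ℝ (flux α a x (p.grad t x)) (p.grad t x)) +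
        ENNReal.ofReal (a (Fin.last N) x)) + ENNReal.ofReal (W1 α a x * ‖Ψ.grad t x‖ ^ r)) := by
    intro x hx
    have ha := h.coefficients.coeffAt hx
    have hN := h.coefficients.last_pos x hx
    have hW := W1_nonneg (α := α) ha
    have h1 := W1_mul_rpow_le h.exponents ha hN (norm_nonneg (p.grad t x))
    rw [← inner_flux_self h.exponents ha] at h1
    have h2 : ‖p.grad t x - Ψ.grad t x‖ ^ r ≤ 4 * (‖p.grad t x‖ ^ r + ‖Ψ.grad t x‖ ^ r) :=
      (Real.rpow_le_rpow (norm_nonneg _) (norm_sub_le _ _) (by linarith)).trans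
        (add_rpow_le (norm_nonneg _) (norm_nonneg _) (by linarith) (by linarith))
    have h3 := mul_le_mul_of_nonneg_left h2 hW
    have h4 : 0 ≤ inner ℝ (flux α a x (p.grad t x)) (p.grad t x) := by
      rw [inner_flux_self h.exponents ha]
      exact mul_nonneg (root_nonneg h.exponents ha (norm_nonneg _)) (norm_nonneg _)
    have h5 : 0 ≤ W1 α a x * ‖Ψ.grad t x‖ ^ r := by positivity
    rw [← ENNReal.ofReal_add h4 hN.le, ← ENNReal.ofReal_add (by linarith) h5,
      show (4 : ℝ≥0∞) = ENNReal.ofReal 4 by norm_num, ← ENNReal.ofReal_mul (by norm_num)]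
    exact ENNReal.ofReal_le_ofReal (by linarith)
  have hmeas := (h.integrable_inner_flux ht (h.memLp_grad_p ht)).aemeasurable.ennreal_ofReal
  have hmeas' := (h.coefficients.aemeasurable (Fin.last N)).ennreal_ofReal
  refine (setLIntegral_mono' h.measurableSet hpt).trans ?_
  rw [lintegral_const_mul' _ _ (by norm_num), lintegral_add_left' (hmeas.fun_add hmeas'),
    lintegral_add_left' hmeas]
  refine mul_le_mul_right ?_ 4
  have hH : ∫⁻ x in U, ENNReal.ofReal (inner ℝ (flux α a x (p.grad t x)) (p.grad t x)) ≤
      intH α a p t := setLIntegral_mono' h.measurableSet fun x hx => by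
    rw [inner_flux_self h.exponents (h.coefficients.coeffAt hx)]
    exact ENNReal.ofReal_le_ofReal
      (root_mul_le_H h.exponents (h.coefficients.coeffAt hx) (norm_nonneg _))
  rw [add_assoc]
  refine add_le_add hH ?_
  unfold G
  refine (add_le_add (le_max_left (posInt U (a (Fin.last N))) 1) le_rfl).trans ?_
  change Bstar U a + posInt U (fun x => W1 α a x * ‖Ψ.grad t x‖ ^ r) ≤ _
  exact (add_le_add le_self_add le_rfl).trans le_self_add

/-- The Poincaré inequality in terms of the energy. -/
theorem norm_rpow_le (h : IsFlow U α a φ cP p Ψ) (hcP : 0 < cP) {t : ℝ} (ht : 0 < t) :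
    ‖toL2 (wMeasure U φ) (fun x => p.val t x - Ψ.val t x)‖ ^ (2 - expo α) ≤
      4 * cP ^ (2 - expo α) * ((intH α a p t).toReal + (G α a Ψ t).toReal) := by
  have he0 := expo_pos h.exponents
  have he1 := expo_lt_one h.exponents
  have hP := h.poincare t ht
  have hS := h.posInt_W1_le ht
  set r := 2 - expo α with hr
  have hr0 : 0 < r := by linarith
  set S := posInt U (fun x => W1 α a x * ‖p.grad t x - Ψ.grad t x‖ ^ r)
  set ν := ‖toL2 (wMeasure U φ) (fun x => p.val t x - Ψ.val t x)‖ with hν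
  have hν0 : 0 ≤ ν := norm_nonneg _
  have hH := h.finite_H.1 t ht.le
  have hG := h.finite_G.1 t ht.le
  have hfin : 4 * (intH α a p t + G α a Ψ t) ≠ ⊤ :=
    ENNReal.mul_ne_top (by norm_num) (ENNReal.add_ne_top.2 ⟨hH, hG⟩)
  have h1 : S.toReal ≤ 4 * ((intH α a p t).toReal + (G α a Ψ t).toReal) := by
    have := ENNReal.toReal_mono hfin hS
    rwa [ENNReal.toReal_mul, ENNReal.toReal_add hH hG, ENNReal.toReal_ofNat] at this
  have e1 : normSq p Ψ t ^ (1 / 2 : ℝ) = ENNReal.ofReal ν := by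
    rw [h.normSq_eq ht.le, ← hν, ENNReal.ofReal_rpow_of_nonneg (sq_nonneg _) (by norm_num),
      ← Real.sqrt_eq_rpow, Real.sqrt_sq hν0]
  have e2 : S ^ (1 / r) = ENNReal.ofReal (S.toReal ^ (1 / r)) := by
    rw [← ENNReal.ofReal_rpow_of_nonneg ENNReal.toReal_nonneg (by positivity),
      ENNReal.ofReal_toReal (ne_top_of_le_ne_top hfin hS)]
  rw [e1, e2, ← ENNReal.ofReal_mul hcP.le, ENNReal.ofReal_le_ofReal_iff (by positivity)] at hP
  have h2 := Real.rpow_le_rpow hν0 hP hr0.le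
  rw [Real.mul_rpow hcP.le (by positivity), ← Real.rpow_mul ENNReal.toReal_nonneg,
    one_div_mul_cancel hr0.ne', Real.rpow_one] at h2
  have := mul_le_mul_of_nonneg_left h1 (Real.rpow_nonneg hcP.le r)
  linarith

theorem one_le_toReal_G (h : IsFlow U α a φ cP p Ψ) {t : ℝ} (ht : 0 ≤ t) :
    1 ≤ (G α a Ψ t).toReal := by
  have := ENNReal.toReal_mono (h.finite_G.1 t ht) (one_le_G t)
  simpa using this

theorem norm_dt_rpow_le (h : IsFlow U α a φ cP p Ψ) {t : ℝ} (ht : 0 < t) :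
    ‖toL2 (wMeasure U φ) (Ψ.dt t)‖ ^ ((2 - expo α) / (2 - expo α - 1)) ≤ (G α a Ψ t).toReal := by
  have he0 := expo_pos h.exponents
  have he1 := expo_lt_one h.exponents
  have e1 : posInt U (fun x => Ψ.dt t x ^ 2 * φ x) =
      ENNReal.ofReal (‖toL2 (wMeasure U φ) (Ψ.dt t)‖ ^ 2) :=
    posInt_eq_ofReal_norm_sq h.measurableSet h.porosity.aemeasurable h.porosity_nonneg
      (Ψ.hasDeriv_val t ht).1 fun x _ => by rw [Real.norm_eq_abs, sq_abs, mul_comm]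
  have h1 : posInt U (fun x => Ψ.dt t x ^ 2 * φ x) ^ ((2 - expo α) / (2 * (1 - expo α))) ≤
      G α a Ψ t := by unfold G; exact le_add_self
  have hexp : 0 ≤ (2 - expo α) / (2 * (1 - expo α)) :=
    div_nonneg (by linarith) (by linarith)
  rw [e1, ENNReal.ofReal_rpow_of_nonneg (sq_nonneg _) hexp,
    ENNReal.ofReal_le_iff_le_toReal (h.finite_G.1 t ht.le), ← Real.rpow_two,
    ← Real.rpow_mul (norm_nonneg _)] at h1
  convert h1 using 2
  have : 1 - expo α ≠ 0 := by linarith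
  rw [show 2 - expo α - 1 = 1 - expo α by ring]
  field_simp

theorem energyInequalities (h : IsFlow U α a φ cP p Ψ) (hcP : 0 < cP) :
    EnergyInequalities (2 - expo α) (energyConst (2 - expo α) (4 * cP ^ (2 - expo α)))
      (fun t => ‖toL2 (wMeasure U φ) (fun x => p.val t x - Ψ.val t x)‖ ^ 2)
      (fun t => ‖toL2 (wMeasure U φ) (fun x => p.dt t x - Ψ.dt t x)‖ ^ 2)
      (fun t => (intH α a p t).toReal) (fun t => (G α a Ψ t).toReal)
      (fun t => (G1 a Ψ t).toReal) (fun t => (G2 Ψ t).toReal) := by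
  have he0 := expo_pos h.exponents
  have he1 := expo_lt_one h.exponents
  refine h.evolutionCurves.energyInequalities (by linarith) (by positivity)
    (fun _ _ => ENNReal.toReal_nonneg) (fun _ _ => ENNReal.toReal_nonneg)
    (fun _ _ => ENNReal.toReal_nonneg) (fun t ht => h.one_le_toReal_G ht) ?_
    h.finite_H.continuousOn_toReal h.finite_G.continuousOn_toReal h.finite_G1.continuousOn_toReal
    h.finite_G2.continuousOn_toReal ?_ ?_ (fun t ht => h.norm_dt_rpow_le ht) ?_ ?_
    (fun t ht => h.norm_rpow_le hcP ht)
  · refine tendsto_toL2 h.memLp_val_zero ?_ (p.tendsto_sub_zero Ψ)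
    filter_upwards [self_mem_nhdsWithin] with t ht using h.memLp_val ht
  · intro t ht
    rw [← ENNReal.ofReal_le_iff_le_toReal (h.finite_G.1 t ht.le),
      ← posInt_eq_ofReal_norm_sq h.measurableSet h.weight_aemeasurable h.weight_nonneg
        (h.memLp_grad_Ψ ht.le) (fun _ _ => rfl)]
    unfold G
    exact (le_add_self.trans le_self_add).trans le_self_add
  · intro t ht
    have h1 := h.norm_dt_rpow_le ht
    have h2 := h.one_le_toReal_G ht.le
    rcases le_total ‖toL2 (wMeasure U φ) (Ψ.dt t)‖ 1 with h3 | h3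
    · exact (pow_le_one₀ (norm_nonneg _) h3).trans h2
    · refine le_trans ?_ h1
      rw [← Real.rpow_two]
      refine Real.rpow_le_rpow_of_exponent_le h3 ?_
      rw [le_div_iff₀ (by linarith)]
      linarith
  · intro t ht
    rw [← ENNReal.ofReal_le_iff_le_toReal (h.finite_G1.1 t ht.le),
      ← posInt_eq_ofReal_norm_sq h.measurableSet h.weight_aemeasurable h.weight_nonneg
        (Ψ.hasDeriv_grad t ht).1 (fun _ _ => rfl)]
    exact le_rfl
  · intro t ht
    rw [← ENNReal.ofReal_le_iff_le_toReal (h.finite_G2.1 t ht.le),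
      ← posInt_eq_ofReal_norm_sq h.measurableSet h.porosity.aemeasurable h.porosity_nonneg
        (Ψ.hasDeriv_dt t ht).1 (k := fun x => Ψ.dtt t x ^ 2 * φ x)
        fun x _ => by rw [Real.norm_eq_abs, sq_abs, mul_comm]]
    exact le_rfl

end IsFlow

/-! ### From real to extended nonnegative quantities -/

theorem lintegral_Ioc_eq_ofReal {F : ℝ → ℝ≥0∞} {f : ℝ → ℝ} {s t : ℝ} (hs : 0 ≤ s) (hst : s ≤ t)
    (hf : ContinuousOn f (Ici 0)) (hf0 : ∀ τ, 0 ≤ τ → 0 ≤ f τ)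
    (hF : ∀ τ, 0 ≤ τ → F τ = ENNReal.ofReal (f τ)) :
    ∫⁻ τ in Ioc s t, F τ = ENNReal.ofReal (∫ τ in s..t, f τ) := by
  have hsub : ∀ τ ∈ Ioc s t, 0 ≤ τ := fun τ hτ => hs.trans hτ.1.le
  rw [intervalIntegral.integral_of_le hst, ofReal_integral_eq_lintegral_ofReal]
  · exact setLIntegral_congr_fun measurableSet_Ioc fun τ hτ => hF τ (hsub τ hτ)
  · exact ((hf.mono fun τ (hτ : τ ∈ Icc s t) => hs.trans hτ.1).integrableOn_Icc).mono_set
      Ioc_subset_Icc_self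
  · exact (ae_restrict_iff' measurableSet_Ioc).2
      (Eventually.of_forall fun τ hτ => hf0 τ (hsub τ hτ))

theorem limsup_const_mul_const_add {u : ℝ → ℝ≥0∞} (c : ℝ≥0) (d : ℝ≥0∞) :
    limsup (fun t => (c : ℝ≥0∞) * (d + u t)) atTop = c * (d + limsup u atTop) := by
  rw [ENNReal.limsup_const_mul_of_ne_top ENNReal.coe_ne_top,
    limsup_const_add atTop u d (by isBoundedDefault) (by isBoundedDefault)]

theorem limsup_lintegral_Ioc_le (f : ℝ → ℝ≥0∞) :
    limsup (fun t => ∫⁻ τ in Ioc (t - 1) t, f τ) atTop ≤ limsup f atTop := by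
  refine le_of_forall_gt_imp_ge_of_dense fun c hc => ?_
  obtain ⟨T, hT⟩ := eventually_atTop.1 (eventually_lt_of_limsup_lt hc)
  refine limsup_le_of_le (by isBoundedDefault) ?_
  filter_upwards [eventually_ge_atTop (T + 1)] with t ht
  calc ∫⁻ τ in Ioc (t - 1) t, f τ ≤ ∫⁻ _ in Ioc (t - 1) t, c :=
        setLIntegral_mono' measurableSet_Ioc fun τ hτ => (hT τ (by have := hτ.1; linarith)).le
    _ = c := by simp

namespace IsFlow

theorem lintegral_data (h : IsFlow U α a φ cP p Ψ) {t : ℝ} (ht : 1 ≤ t) :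
    ∫⁻ τ in Ioc (t - 1) t, (G1 a Ψ τ + G2 Ψ τ) =
      ENNReal.ofReal (∫ τ in (t - 1)..t, ((G1 a Ψ τ).toReal + (G2 Ψ τ).toReal)) :=
  lintegral_Ioc_eq_ofReal (by linarith) (by linarith)
    (h.finite_G1.continuousOn_toReal.add h.finite_G2.continuousOn_toReal)
    (fun _ _ => add_nonneg ENNReal.toReal_nonneg ENNReal.toReal_nonneg) fun τ hτ => by
      rw [ENNReal.ofReal_add ENNReal.toReal_nonneg ENNReal.toReal_nonneg,
        ENNReal.ofReal_toReal (h.finite_G1.1 τ hτ), ENNReal.ofReal_toReal (h.finite_G2.1 τ hτ)]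

theorem integral_data_nonneg (t : ℝ) :
    0 ≤ ∫ τ in (t - 1)..t, ((G1 a Ψ τ).toReal + (G2 Ψ τ).toReal) :=
  intervalIntegral.integral_nonneg (by linarith) fun _ _ =>
    add_nonneg ENNReal.toReal_nonneg ENNReal.toReal_nonneg

theorem toReal_G_le_majorant {M : ℝ → ℝ}
    (hM : IsMajorant (G α a Ψ) M) {τ t : ℝ} (hτ : τ ∈ Icc 0 t) : (G α a Ψ τ).toReal ≤ M t := by
  have h1 := hM.le τ hτ.1
  have h2 : 1 ≤ M τ := by
    rw [← ENNReal.one_le_ofReal]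
    exact (one_le_G τ).trans h1
  exact (ENNReal.toReal_le_of_le_ofReal (by linarith) h1).trans
    (hM.monotoneOn hτ.1 (hτ.1.trans hτ.2) hτ.2)

theorem one_le_majorant (h : IsFlow U α a φ cP p Ψ) {M : ℝ → ℝ}
    (hM : IsMajorant (G α a Ψ) M) {t : ℝ} (ht : 0 ≤ t) : 1 ≤ M t :=
  (h.one_le_toReal_G ht).trans (toReal_G_le_majorant hM ⟨ht, le_rfl⟩)

end IsFlow

end Flow

end Forchheimer

end

theorem mainTheorem5 {n N : ℕ} (U : Set (Forchheimer.Space n)) (hUo : IsOpen U)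
    (hUb : Bornology.IsBounded U) (α : Fin (N + 1) → ℝ) (hα : Forchheimer.IsExponents α)
    (cP : ℝ) (hcP : 0 < cP) :
    ∃ C : ℝ≥0, 0 < C ∧
      ∀ (a : Fin (N + 1) → Forchheimer.Space n → ℝ) (φ : Forchheimer.Space n → ℝ)
        (p Ψ : Forchheimer.RegularFun U φ (fun x => (a 0 x)⁻¹)),
        Forchheimer.IsCoefficients U a → Forchheimer.IsPorosity U φ →
        Forchheimer.IsSolution U α a φ p Ψ →
        Forchheimer.PoincareSobolev α a cP p Ψ →
        Forchheimer.FiniteContinuous (Forchheimer.G α a Ψ) →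
        Forchheimer.FiniteContinuous (Forchheimer.G1 a Ψ) →
        Forchheimer.FiniteContinuous (Forchheimer.G2 Ψ) →
        Forchheimer.FiniteContinuous (Forchheimer.intH α a p) →
        -- (i)
        (∀ M : ℝ → ℝ, Forchheimer.IsMajorant (Forchheimer.G α a Ψ) M →
          ∀ t₀ ∈ Ioc (0 : ℝ) 1, ∀ t, t₀ ≤ t →
            Forchheimer.intH α a p t + Forchheimer.normSqDt p Ψ t ≤
              C * ((ENNReal.ofReal t₀)⁻¹ * (Forchheimer.intH α a p 0 + Forchheimer.normSq p Ψ 0)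
                + (ENNReal.ofReal t₀)⁻¹ * (∫⁻ τ in Ioc 0 t₀, Forchheimer.G1 a Ψ τ)
                + ENNReal.ofReal (M t) ^ (2 / (2 - Forchheimer.expo α))
                + ∫⁻ τ in Ioc 0 t, ENNReal.ofReal (Real.exp (-(1 / 4) * (t - τ))) *
                    (Forchheimer.G1 a Ψ τ + Forchheimer.G2 Ψ τ))) ∧
        -- (ii)
        (∀ M : ℝ → ℝ, Forchheimer.IsMajorant (Forchheimer.G α a Ψ) M →
          ∀ t, 1 ≤ t →
            Forchheimer.normSqDt p Ψ t ≤
              C * (Forchheimer.normSq p Ψ 0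
                + ENNReal.ofReal (M t) ^ (2 / (2 - Forchheimer.expo α))
                + ∫⁻ τ in Ioc (t - 1) t, (Forchheimer.G1 a Ψ τ + Forchheimer.G2 Ψ τ))) ∧
        -- (iii)
        (Forchheimer.limA α a Ψ < ⊤ →
          limsup (Forchheimer.normSqDt p Ψ) atTop ≤
              C * (Forchheimer.limA α a Ψ ^ (2 / (2 - Forchheimer.expo α))
                + limsup (fun t => ∫⁻ τ in Ioc (t - 1) t,
                    (Forchheimer.G1 a Ψ τ + Forchheimer.G2 Ψ τ)) atTop) ∧
          limsup (Forchheimer.normSqDt p Ψ) atTop ≤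
              C * (Forchheimer.limA α a Ψ ^ (2 / (2 - Forchheimer.expo α))
                + limsup (fun t => Forchheimer.G1 a Ψ t + Forchheimer.G2 Ψ t) atTop)) ∧
        -- (iv)
        (ContDiffOn ℝ 1 (fun t => (Forchheimer.G α a Ψ t).toReal) (Ioi 0) →
          Forchheimer.limB α a Ψ < ⊤ →
          ∃ T : ℝ, 0 < T ∧ ∀ t, T < t →
            Forchheimer.normSqDt p Ψ t ≤
              C * (Forchheimer.limB α a Ψ ^ (1 / (1 - Forchheimer.expo α))
                + Forchheimer.G α a Ψ t ^ (2 / (2 - Forchheimer.expo α))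
                + ∫⁻ τ in Ioc (t - 1) t,
                    (Forchheimer.G1 a Ψ τ + Forchheimer.G2 Ψ τ))) := by
  have he0 := Forchheimer.expo_pos hα
  have he1 := Forchheimer.expo_lt_one hα
  set r := 2 - Forchheimer.expo α with hr
  have hr1 : 1 < r := by linarith
  have hr2 : r < 2 := by linarith
  have hre : 1 - Forchheimer.expo α = r - 1 := by rw [hr]; ring
  have hc := Forchheimer.one_le_energyConst (r := r) (D := 4 * cP ^ r) (by positivity)
  obtain ⟨C₁, hC₁, H₁⟩ := Forchheimer.EnergyInequalities.I_add_z_bound hc hr1 hr2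
  obtain ⟨C₂, hC₂, H₂⟩ := Forchheimer.EnergyInequalities.z_bound hc hr1 hr2
  obtain ⟨C₃, hC₃, H₃⟩ := Forchheimer.EnergyInequalities.eventually_z_bound hc hr1 hr2
  obtain ⟨C₄, hC₄, H₄⟩ := Forchheimer.EnergyInequalities.eventually_z_bound_of_deriv hc hr1 hr2
  -- the asymptotic estimates come from bounds with `2 𝓐` for `𝓐` and `𝓑 + 1` for `𝓑`; the factors
  -- `4` and `k + 1` account for this
  set k : ℝ := 2 ^ (1 / (r - 1)) with hk
  have hk0 : 0 ≤ k := by positivity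
  set C := C₁ + C₂ + 4 * C₃ + C₄ * (k + 1) with hCdef
  have hC : 0 < C := by positivity
  have hCe : ((C.toNNReal : ℝ≥0) : ℝ≥0∞) = ENNReal.ofReal C := rfl
  refine ⟨C.toNNReal, Real.toNNReal_pos.2 hC, ?_⟩
  intro a φ p Ψ ha hφ hsol hP hG hG1 hG2 hH
  have hf : Forchheimer.IsFlow U α a φ cP p Ψ := ⟨hUo, hα, ha, hφ, hsol, hP, hG, hG1, hG2, hH⟩
  have hE := hf.energyInequalities hcP
  rw [← hr] at hE
  have hk4 : 0 ≤ C₄ * (k + 1) := by positivity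
  have hexp : 0 ≤ 2 / r := by positivity
  refine ⟨?_, ?_, ?_, ?_⟩
  · intro M hM t₀ ht₀ t htt
    have ht0 : 0 < t := ht₀.1.trans_le htt
    have hM1 := hf.one_le_majorant hM ht0.le
    have key := H₁ hE ht₀.1 ht₀.2 htt fun τ hτ => Forchheimer.IsFlow.toReal_G_le_majorant hM hτ
    beta_reduce at key
    have i1 : 0 ≤ ∫ τ in (0 : ℝ)..t₀, (Forchheimer.G1 a Ψ τ).toReal :=
      intervalIntegral.integral_nonneg ht₀.1.le fun _ _ => ENNReal.toReal_nonneg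
    have i2 : 0 ≤ ∫ τ in (0 : ℝ)..t, Real.exp (-(1 / 4) * (t - τ)) *
        ((Forchheimer.G1 a Ψ τ).toReal + (Forchheimer.G2 Ψ τ).toReal) :=
      intervalIntegral.integral_nonneg ht0.le fun _ _ => mul_nonneg (Real.exp_pos _).le
        (add_nonneg ENNReal.toReal_nonneg ENNReal.toReal_nonneg)
    have L1 : ∫⁻ τ in Ioc 0 t₀, Forchheimer.G1 a Ψ τ = _ :=
      Forchheimer.lintegral_Ioc_eq_ofReal le_rfl ht₀.1.le hG1.continuousOn_toReal
        (fun _ _ => ENNReal.toReal_nonneg) fun τ hτ => (ENNReal.ofReal_toReal (hG1.1 τ hτ)).symm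
    have L2 : ∫⁻ τ in Ioc 0 t, ENNReal.ofReal (Real.exp (-(1 / 4) * (t - τ))) *
        (Forchheimer.G1 a Ψ τ + Forchheimer.G2 Ψ τ) = _ :=
      Forchheimer.lintegral_Ioc_eq_ofReal (f := fun τ => Real.exp (-(1 / 4) * (t - τ)) *
        ((Forchheimer.G1 a Ψ τ).toReal + (Forchheimer.G2 Ψ τ).toReal)) le_rfl ht0.le
        (ContinuousOn.mul (by fun_prop) (hG1.continuousOn_toReal.add hG2.continuousOn_toReal))
        (fun _ _ => mul_nonneg (Real.exp_pos _).le
          (add_nonneg ENNReal.toReal_nonneg ENNReal.toReal_nonneg)) fun τ hτ => by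
          rw [ENNReal.ofReal_mul (Real.exp_pos _).le,
            ENNReal.ofReal_add ENNReal.toReal_nonneg ENNReal.toReal_nonneg,
            ENNReal.ofReal_toReal (hG1.1 τ hτ), ENNReal.ofReal_toReal (hG2.1 τ hτ)]
    have hinv : 0 ≤ t₀⁻¹ := (inv_pos.2 ht₀.1).le
    have hMr : 0 ≤ M t ^ (2 / r) := by positivity
    rw [L1, L2, hCe, ENNReal.ofReal_rpow_of_nonneg (by linarith) hexp,
      ← ENNReal.ofReal_toReal (hH.1 t ht0.le), ← ENNReal.ofReal_toReal (hH.1 0 le_rfl),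
      hf.normSqDt_eq ht0, hf.normSq_eq le_rfl, ← ENNReal.ofReal_inv_of_pos ht₀.1,
      ← ENNReal.ofReal_add ENNReal.toReal_nonneg (sq_nonneg _),
      ← ENNReal.ofReal_add ENNReal.toReal_nonneg (sq_nonneg _),
      ← ENNReal.ofReal_mul hinv, ← ENNReal.ofReal_mul hinv,
      ← ENNReal.ofReal_add (by positivity) (by positivity),
      ← ENNReal.ofReal_add (by positivity) hMr,
      ← ENNReal.ofReal_add (by positivity) i2, ← ENNReal.ofReal_mul hC.le]
    refine ENNReal.ofReal_le_ofReal (key.trans ?_)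
    refine mul_le_mul_of_nonneg_right (by linarith) (by positivity)
  · intro M hM t ht
    have hM1 := hf.one_le_majorant hM (by linarith : 0 ≤ t)
    have key := H₂ hE ht fun τ hτ => Forchheimer.IsFlow.toReal_G_le_majorant hM hτ
    beta_reduce at key
    have i1 := Forchheimer.IsFlow.integral_data_nonneg (a := a) (Ψ := Ψ) t
    have hMr : 0 ≤ M t ^ (2 / r) := by positivity
    rw [hf.lintegral_data ht, hCe, ENNReal.ofReal_rpow_of_nonneg (by linarith) hexp,
      hf.normSqDt_eq (by linarith), hf.normSq_eq le_rfl, ← ENNReal.ofReal_add (by positivity) hMr,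
      ← ENNReal.ofReal_add (by positivity) i1, ← ENNReal.ofReal_mul hC.le]
    refine ENNReal.ofReal_le_ofReal (key.trans ?_)
    refine mul_le_mul_of_nonneg_right (by linarith) (by positivity)
  · intro hA
    have hA1 : 1 ≤ Forchheimer.limA α a Ψ :=
      le_limsup_of_frequently_le' (Frequently.of_forall fun t => Forchheimer.one_le_G t)
    set A := Forchheimer.limA α a Ψ with hAdef
    have hAr : 1 ≤ A.toReal := by simpa using ENNReal.toReal_mono hA.ne hA1
    have hlt : limsup (Forchheimer.G α a Ψ) atTop < ENNReal.ofReal (2 * A.toReal) := by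
      change A < _
      rw [ENNReal.lt_ofReal_iff_toReal_lt hA.ne]
      linarith
    have hev : ∀ᶠ τ in atTop, (Forchheimer.G α a Ψ τ).toReal ≤ 2 * A.toReal :=
      (eventually_lt_of_limsup_lt hlt).mono fun τ hτ =>
        ENNReal.toReal_le_of_le_ofReal (by linarith) hτ.le
    have main : limsup (Forchheimer.normSqDt p Ψ) atTop ≤
        (C.toNNReal : ℝ≥0∞) * (A ^ (2 / r) + limsup (fun t => ∫⁻ τ in Ioc (t - 1) t,
          (Forchheimer.G1 a Ψ τ + Forchheimer.G2 Ψ τ)) atTop) := by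
      rw [← Forchheimer.limsup_const_mul_const_add]
      refine limsup_le_limsup ?_
      filter_upwards [H₃ hE hev, eventually_ge_atTop 1] with t key ht
      have i1 := Forchheimer.IsFlow.integral_data_nonneg (a := a) (Ψ := Ψ) t
      have hAr2 : 0 ≤ A.toReal ^ (2 / r) := by positivity
      rw [hf.lintegral_data ht, hCe, hf.normSqDt_eq (by linarith), ← ENNReal.ofReal_toReal hA.ne,
        ENNReal.ofReal_rpow_of_nonneg ENNReal.toReal_nonneg hexp, ← ENNReal.ofReal_add hAr2 i1,
        ← ENNReal.ofReal_mul hC.le]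
      refine ENNReal.ofReal_le_ofReal (key.trans ?_)
      have h4 : (2 * A.toReal) ^ (2 / r) ≤ 4 * A.toReal ^ (2 / r) := by
        rw [Real.mul_rpow (by norm_num) ENNReal.toReal_nonneg]
        refine mul_le_mul_of_nonneg_right ?_ hAr2
        calc (2 : ℝ) ^ (2 / r) ≤ 2 ^ (2 : ℝ) :=
              Real.rpow_le_rpow_of_exponent_le (by norm_num)
                (by rw [div_le_iff₀ (by linarith)]; linarith)
          _ = 4 := by norm_num
      generalize (∫ τ in (t - 1)..t,
        ((Forchheimer.G1 a Ψ τ).toReal + (Forchheimer.G2 Ψ τ).toReal)) = J at *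
      calc _ ≤ C₃ * (4 * A.toReal ^ (2 / r) + 4 * J) :=
            mul_le_mul_of_nonneg_left (add_le_add h4 (by linarith)) hC₃.le
        _ = 4 * C₃ * (A.toReal ^ (2 / r) + J) := by ring
        _ ≤ _ := mul_le_mul_of_nonneg_right (by linarith) (by positivity)
    refine ⟨main, main.trans ?_⟩
    gcongr
    exact Forchheimer.limsup_lintegral_Ioc_le _
  · intro hGd hB
    set B := Forchheimer.limB α a Ψ with hBdef
    have hlt : limsup (fun t => ENNReal.ofReal
        (- deriv (fun s => (Forchheimer.G α a Ψ s).toReal) t)) atTop <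
        ENNReal.ofReal (B.toReal + 1) := by
      change B < _
      rw [ENNReal.lt_ofReal_iff_toReal_lt hB.ne]
      linarith
    have hB0 : 0 ≤ B.toReal := ENNReal.toReal_nonneg
    have hev : ∀ᶠ τ in atTop, DifferentiableAt ℝ (fun s => (Forchheimer.G α a Ψ s).toReal) τ ∧
        - deriv (fun s => (Forchheimer.G α a Ψ s).toReal) τ ≤ B.toReal + 1 := by
      filter_upwards [eventually_lt_of_limsup_lt hlt, eventually_gt_atTop 0] with τ h1 h2
      refine ⟨(hGd.contDiffAt (Ioi_mem_nhds h2)).differentiableAt one_ne_zero, ?_⟩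
      exact (ENNReal.ofReal_le_ofReal_iff (by linarith)).1 h1.le
    obtain ⟨T, hT⟩ := eventually_atTop.1 (H₄ hE (by linarith) hev)
    refine ⟨max T 1, by positivity, fun t ht => ?_⟩
    have ht1 : 1 ≤ t := (le_max_right _ _).trans ht.le
    have key := hT t ((le_max_left _ _).trans ht.le)
    beta_reduce at key
    have hΓ := hf.one_le_toReal_G (by linarith : 0 ≤ t)
    have i1 := Forchheimer.IsFlow.integral_data_nonneg (a := a) (Ψ := Ψ) t
    have hexp' : 0 ≤ 1 / (r - 1) := one_div_nonneg.2 (by linarith)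
    set Γ := (Forchheimer.G α a Ψ t).toReal with hΓdef
    have hΓr : 1 ≤ Γ ^ (2 / r) := Real.one_le_rpow hΓ hexp
    have hBr : 0 ≤ B.toReal ^ (1 / (r - 1)) := by positivity
    rw [hre, hf.lintegral_data ht1, hCe, hf.normSqDt_eq (by linarith),
      ← ENNReal.ofReal_toReal hB.ne, ← ENNReal.ofReal_toReal (hG.1 t (by linarith)), ← hΓdef,
      ENNReal.ofReal_rpow_of_nonneg hB0 hexp', ENNReal.ofReal_rpow_of_nonneg (by linarith) hexp,
      ← ENNReal.ofReal_add hBr (by linarith), ← ENNReal.ofReal_add (by linarith) i1,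
      ← ENNReal.ofReal_mul hC.le]
    refine ENNReal.ofReal_le_ofReal (key.trans ?_)
    have h4 : (B.toReal + 1) ^ (1 / (r - 1)) ≤ k * (B.toReal ^ (1 / (r - 1)) + 1) := by
      have hmax : B.toReal + 1 ≤ 2 * max B.toReal 1 := by
        linarith [le_max_left B.toReal 1, le_max_right B.toReal 1]
      have h5 : max B.toReal 1 ^ (1 / (r - 1)) ≤ B.toReal ^ (1 / (r - 1)) + 1 := by
        rcases max_choice B.toReal 1 with hh | hh <;> rw [hh]
        · linarith
        · rw [Real.one_rpow]; linarith
      calc _ ≤ (2 * max B.toReal 1) ^ (1 / (r - 1)) := by gcongr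
        _ = k * max B.toReal 1 ^ (1 / (r - 1)) := Real.mul_rpow (by norm_num) (by positivity)
        _ ≤ _ := by gcongr
    generalize (∫ τ in (t - 1)..t,
      ((Forchheimer.G1 a Ψ τ).toReal + (Forchheimer.G2 Ψ τ).toReal)) = J at *
    generalize B.toReal ^ (1 / (r - 1)) = b' at *
    generalize Γ ^ (2 / r) = G' at *
    have h6 : (B.toReal + 1) ^ (1 / (r - 1)) + G' + J ≤ (k + 1) * (b' + G' + J) := by
      nlinarith [mul_nonneg hk0 i1, mul_le_mul_of_nonneg_left hΓr hk0]
    calc _ ≤ C₄ * ((k + 1) * (b' + G' + J)) := mul_le_mul_of_nonneg_left h6 hC₄.le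
      _ = C₄ * (k + 1) * (b' + G' + J) := by ring
      _ ≤ _ := mul_le_mul_of_nonneg_right (by linarith) (by linarith)
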